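/- Let $\mathcal B=\mathbb C[[x,y;p,p^{-1}]]$ with $x=(x_1,x_2,\dots)$, $y=(y_1,y_2,\dots)$ be the space of formal series $\sum_{m\in\mathbb Z}f_m(x,y)\,p^m$ with $f_m\in\mathbb C[[x,y]]$. For a sequence $t=(t_1,t_2,\dots)$ let the elementary Schur polynomials $S_k(t)$, $k\in\mathbb Z$, be given by $\sum_{k\ge 0}S_k(t)z^k=\exp\big(\sum_{n\ge1}t_nz^n\big)$ and $S_k(t)=0$ for $k<0$. Let the operators $\varphi_i,\varphi^*_i$ $(i\in\mathbb Z)$ on $\mathcal B$ be the modes of $\varphi(z)=\sum_i\varphi_iz^{-i-1}$ and $\varphi^*(z)=\sum_i\varphi^*_iz^{-i}$, where $$\varphi(z)=p^{-1}\exp\Big(-\sum_{n>0}(x_n+y_n)z^n\Big)\exp\Big(\sum_{n>0}(\partial_{x_n}-\partial_{y_n})\frac{z^{-n}}n\Big),$$ $$\varphi^*(z)=p\exp\Big(\sum_{n>0}(x_n+y_n)z^n\Big)\Big(\sum_{k>0}kx_kz^{k-1}+\sum_{k>0}\partial_{x_k}z^{-k-1}+p\partial_p\,z^{-1}\Big)\exp\Big(-\sum_{n>0}(\partial_{x_n}-\partial_{y_n})\frac{z^{-n}}n\Big).$$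 Let $j\ge1$ be an integer, $a\in\mathbb C$, and $D=1-aS_{j+1}(-x-y)-aS_1(x+y)S_j(-x-y)$. Then $D$ is invertible in $\mathbb C[[x,y]]$ and $$\exp(a\varphi_{-j}\varphi^*_{-1})\cdot1=\frac1D\,\exp\left(-\sum_{n\ge1}\sum_{0\le i\le n}\frac{\binom ni S_1(x+y)^{n-i}(n+i)x_{n+i}}{n}\left(\frac{-aS_{j-1}(-x-y)}{D}\right)^n\right)$$ in $\mathcal B$. Here the series $\sum_{n\ge0}\frac1{n!}(a\varphi_{-j}\varphi^*_{-1})^n\cdot1$ on the left and the sum over $n$ in the exponent on the right converge coefficientwise (each monomial occurs in only finitely many terms), and the exponent has zero constant term. -/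

import Mathlib

namespace FreeBoson

open scoped Nat

noncomputable section

/-! ### Elementary Schur polynomials -/

/-- The series `∑_{n ≥ 1} t_n z^n` with coefficients in a (not necessarily commutative) ring. -/
def genSeries {A : Type*} [Ring A] (t : ℕ+ → A) : PowerSeries A :=
  PowerSeries.mk fun n => if h : 0 < n then t ⟨n, h⟩ else 0

/-- The elementary Schur polynomial `S_k(t)`, i.e. the coefficient of `z^k` in
`exp (∑_{n ≥ 1} t_n z^n) = ∑_m (1/m!) (∑_{n ≥ 1} t_n z^n)^m`, and `0` for `k < 0`.
Since the exponent has no constant term, only the summands with `m ≤ k` contribute to `z^k`.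
The entries `t_n` may be power series or commuting operators. -/
def schurS {A : Type*} [Ring A] [Algebra ℂ A] (t : ℕ+ → A) (k : ℤ) : A :=
  if k < 0 then 0
  else ∑ m ∈ Finset.range (k.toNat + 1),
    ((m ! : ℂ)⁻¹) • PowerSeries.coeff k.toNat (genSeries t ^ m)

/-! ### The algebra `ℂ[[x, y]]` and formal infinite sums -/

/-- `ℂ[[x, y]]` with `x = (x₁, x₂, …)` and `y = (y₁, y₂, …)`. -/
abbrev XY : Type := MvPowerSeries (ℕ+ ⊕ ℕ+) ℂ

/-- The variable `x_n`. -/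
def x (n : ℕ+) : XY := MvPowerSeries.X (Sum.inl n)

/-- The variable `y_n`. -/
def y (n : ℕ+) : XY := MvPowerSeries.X (Sum.inr n)

/-- The operator `∂/∂x_n` on `ℂ[[x, y]]`. -/
def dx (n : ℕ+) : Module.End ℂ XY := (MvPowerSeries.pderiv ℂ (Sum.inl n)).toLinearMap

/-- The operator `∂/∂y_n` on `ℂ[[x, y]]`. -/
def dy (n : ℕ+) : Module.End ℂ XY := (MvPowerSeries.pderiv ℂ (Sum.inr n)).toLinearMap

/-- A family of power series is formally summable if every monomial occurs in only finitely many
members of the family. -/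
def FormallySummable {ι : Type*} (f : ι → XY) : Prop :=
  ∀ d, {i | MvPowerSeries.coeff d (f i) ≠ 0}.Finite

/-- The sum, taken coefficient by coefficient, of a formally summable family of power series. -/
def formalSum {ι : Type*} (f : ι → XY) : XY :=
  fun d => ∑ᶠ i, MvPowerSeries.coeff d (f i)

/-! ### The completed bosonic Fock space -/

/-- The completed bosonic Fock space `ℂ[[x, y; p, p⁻¹]]`: the element `∑_m f_m(x, y) p^m`
(`m` running through all integers) is the function `m ↦ f_m`. -/
abbrev Fock : Type := ℤ → XY

/-- The inclusion `ℂ[[x, y]] → ℂ[[x, y; p, p⁻¹]]`, `f ↦ f p^0`. -/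
def ofXY (f : XY) : Fock := Pi.single 0 f

/-- The mode `α_k` of the Heisenberg field `α(z) = ∑_k α_k z^{-k-1}` on `ℂ[[x, y]] p^c`:
`α_k = ∂/∂x_k` and `α_{-k} = k x_k` for `k > 0`, and `α_0 = p ∂/∂p`, which is multiplication
by `c`. -/
def alpha (c : ℤ) (k : ℤ) (f : XY) : XY :=
  if h : 0 < k then dx ⟨k.toNat, by omega⟩ f
  else if h' : k < 0 then ((-k : ℤ) : ℂ) • (x ⟨(-k).toNat, by omega⟩ * f)
  else (c : ℂ) • f

/-- The mode `φ_i` of `φ(z) = ∑_i φ_i z^{-i-1}`, where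
`φ(z) = p⁻¹ exp(-∑_{n>0} (x_n + y_n) z^n) exp(∑_{n>0} (∂x_n - ∂y_n) z^{-n} / n)`.
The coefficient of `z^{-i-1}` collects the products of the coefficient of `z^{b-i-1}` of the first
exponential with the coefficient of `z^{-b}` of the second one; multiplication by `p⁻¹` sends
`p^{m+1}` to `p^m`. -/
def phi (i : ℤ) (f : Fock) : Fock := fun m =>
  formalSum fun b : ℕ =>
    schurS (fun n => -(x n + y n)) ((b : ℤ) - i - 1) *
      schurS (fun n => ((n : ℕ) : ℂ)⁻¹ • (dx n - dy n)) b (f (m + 1))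

/-- The mode `φ*_i` of `φ*(z) = ∑_i φ*_i z^{-i}`, where
`φ*(z) = p exp(∑_{n>0} (x_n + y_n) z^n) α(z) exp(-∑_{n>0} (∂x_n - ∂y_n) z^{-n} / n)` with
`α(z) = ∑_{k>0} k x_k z^{k-1} + ∑_{k>0} ∂x_k z^{-k-1} + p∂p z^{-1}`.
The coefficient of `z^{-i}` collects the products of the coefficients of `z^a`, `z^{-k-1}` and
`z^{-b}` of the three factors with `a - k - 1 - b = -i`; multiplication by `p` sends `p^{m-1}` to
`p^m`. -/
def phiStar (i : ℤ) (f : Fock) : Fock := fun m =>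
  formalSum fun ab : ℕ × ℕ =>
    schurS (fun n => x n + y n) ab.1 *
      alpha (m - 1) ((ab.1 : ℤ) - ab.2 - 1 + i)
        (schurS (fun n => -(((n : ℕ) : ℂ)⁻¹ • (dx n - dy n))) ab.2 (f (m - 1)))

/-- `exp(T) · v = w`: for every `m` the series `∑_n (1/n!) T^n v` has a formally summable
coefficient of `p^m`, whose sum is the coefficient of `p^m` in `w`. -/
def IsExpApplied (T : Fock → Fock) (v w : Fock) : Prop :=
  ∀ m : ℤ, FormallySummable (fun n : ℕ => ((n ! : ℂ)⁻¹) • (T^[n] v) m) ∧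
    formalSum (fun n : ℕ => ((n ! : ℂ)⁻¹) • (T^[n] v) m) = w m

/-- The exponential of a power series without constant term. -/
def expXY (f : XY) : XY := (PowerSeries.exp ℂ).subst f

/-! ### The ingredients of the formula -/

/-- `S_k(x + y)`. -/
def Splus (k : ℤ) : XY := schurS (fun n => x n + y n) k

/-- `S_k(-x - y)`. -/
def Sminus (k : ℤ) : XY := schurS (fun n => -x n - y n) k

/-- `1 - a S_{j+1}(-x-y) - a S_1(x+y) S_j(-x-y)`. -/
def den (a : ℂ) (j : ℕ) : XY :=
  1 - a • Sminus (j + 1) - a • (Splus 1 * Sminus j)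

/-- For `n ≥ 1`, the summand
`(∑_{0 ≤ i ≤ n} C(n,i) S_1(x+y)^{n-i} (n+i) x_{n+i} / n) (-a S_{j-1}(-x-y) / den)^n`. -/
def expTerm (a : ℂ) (j : ℕ) (n : ℕ+) : XY :=
  (∑ i ∈ Finset.range ((n : ℕ) + 1),
      (((n : ℕ).choose i : ℂ) * (((n : ℕ) + i : ℕ) : ℂ) / ((n : ℕ) : ℂ)) •
        (Splus 1 ^ ((n : ℕ) - i) * x ⟨(n : ℕ) + i, Nat.add_pos_left n.pos i⟩)) *
    (-(a • Sminus ((j : ℤ) - 1)) * (den a j)⁻¹) ^ (n : ℕ)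

end

end FreeBoson

/-! Write `u = x₁ + y₁` and `w = q² + u q`, with `q = z⁻¹` and an auxiliary variable `s`. Let `G =
gSeries` be the exponential of what `log (1 + s w)` becomes when each `q^k` is replaced by `k x_k`.
The operator `exp (∑ q^n (∂x_n - ∂y_n) / n)` fixes every series in the `x_n + y_n` and translates `n
x_n` by `q^n`. Hence it multiplies `G` by `1 + s w` (`schurS_shiftArg_gSeries`), and its inverse
divides `G` by `1 + s w` (`invShift_succ_one`, `invShift_succ_add_two`).

Put `N_k = S_k(-x-y)`, `κ = N_{j+1} + u N_j` and `Q = N_{j-1} + s κ` (`symbol`). The powers of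
`φ_{-j} φ*_{-1}` on the vacuum are `n!` times `[s^n] (Q^n G)` (`iterTerm`). Indeed `φ*_{-1}` sends
`[s^n] (Q^n G)` to `p (n+1) [s^{n+1}] (Q^n G)`, which is the hard step (`sum_alpha_coeff_mul`,
`phiStar_iterTerm`). Then `φ_{-j}` supplies one more factor `Q`, because `1 + s w` has only the
powers `q⁰, q¹, q²` and these select `N_{j-1}`, `N_j`, `N_{j+1}` (`phi_single_coeff_mul`).

It remains to sum `a^n [s^n] (N_{j-1} + s κ)^n G`. Binomial expansion and the negative binomial
series give `D⁻¹ G(a N_{j-1} / D)` with `D = 1 - a κ` (`formalSum_iterTerm`), and this is the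
right-hand side (`expXY_neg_formalSum_expTerm`).

Convergence is controlled by the grading in which `x_n` and `y_n` have weight `n`: the coefficient
of `s^l` in `G` has weight at least `l`. This is what makes the evaluation legitimate when `j = 1`,
where `N_0 = 1` and `a N_0 / D` has constant term `a`. -/

namespace FreeBoson

open scoped Nat
open PowerSeries

noncomputable section

/-! ### Linear differential equations and coefficientwise derivations over `K⟦X⟧`. -/

section Comm

variable {K : Type*} [CommRing K] [Algebra ℂ K]

theorem natCast_succ_mul_eq_zero {c : K} {n : ℕ} (h : c * ((n : K) + 1) = 0) : c = 0 := by
  have h2 : algebraMap ℂ K ((n : ℂ) + 1)⁻¹ * (((n : K) + 1)) = 1 := by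
    have : ((n : K) + 1) = algebraMap ℂ K ((n : ℂ) + 1) := by simp
    rw [this, ← map_mul, inv_mul_cancel₀ (Nat.cast_add_one_ne_zero n), map_one]
  calc c = (c * ((n : K) + 1)) * algebraMap ℂ K ((n : ℂ) + 1)⁻¹ := by
        rw [mul_assoc, mul_comm ((n : K) + 1), h2, mul_one]
    _ = 0 := by rw [h, zero_mul]

/-- A solution of the linear equation `F' = F * T` with zero initial value vanishes. -/
theorem eq_zero_of_derivative_eq_mul {F T : K⟦X⟧} (h : d⁄dX K F = F * T)
    (h0 : constantCoeff F = 0) : F = 0 := by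
  have key : ∀ n, coeff n F = 0 := by
    intro n
    induction n using Nat.strong_induction_on with
    | _ n ih =>
      cases n with
      | zero => simpa using h0
      | succ n =>
        have h1 := congrArg (coeff n) h
        rw [coeff_derivative, coeff_mul, Finset.sum_eq_zero] at h1
        · exact natCast_succ_mul_eq_zero h1
        · intro p hp
          rw [ih p.1 (by have := Finset.HasAntidiagonal.mem_antidiagonal.1 hp; omega), zero_mul]
  ext n
  simpa using key n

theorem eq_of_derivative_eq_mul_add {F H T R : K⟦X⟧} (hF : d⁄dX K F = F * T + R)
    (hH : d⁄dX K H = H * T + R) (h0 : constantCoeff F = constantCoeff H) : F = H := by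
  rw [← sub_eq_zero]
  refine eq_zero_of_derivative_eq_mul (T := T) ?_ (by simp [h0])
  rw [map_sub, hF, hH]
  ring

theorem eq_of_derivative_eq {F H : K⟦X⟧} (h : d⁄dX K F = d⁄dX K H)
    (h0 : constantCoeff F = constantCoeff H) : F = H :=
  eq_of_derivative_eq_mul_add (T := 0) (R := d⁄dX K H) (by simp [h]) (by simp) h0

/-- The derivation of `K⟦X⟧` that applies a derivation of `K` to every coefficient. -/
def mapDer (v : Derivation ℂ K K) : Derivation ℂ K⟦X⟧ K⟦X⟧ :=
  Derivation.mk'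
    { toFun := fun f => PowerSeries.mk fun n => v (coeff n f)
      map_add' := fun f g => by ext n; simp
      map_smul' := fun c f => by ext n; simp }
    (fun f g => by
      ext n
      simp only [LinearMap.coe_mk, AddHom.coe_mk, coeff_mk, coeff_mul, map_sum, map_add,
        Derivation.leibniz, smul_eq_mul, Finset.sum_add_distrib]
      congr 1
      rw [← Finset.Nat.sum_antidiagonal_swap]
      rfl)

@[simp] theorem coeff_mapDer (v : Derivation ℂ K K) (f : K⟦X⟧) (n : ℕ) :
    coeff n (mapDer v f) = v (coeff n f) := by
  simp [mapDer]

@[simp] theorem mapDer_C (v : Derivation ℂ K K) (a : K) : mapDer v (C a) = C (v a) := by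
  ext n
  rw [coeff_mapDer, coeff_C, coeff_C]
  split_ifs <;> simp

@[simp] theorem mapDer_X (v : Derivation ℂ K K) : mapDer v (X : K⟦X⟧) = 0 := by
  ext n
  rw [coeff_mapDer, coeff_X]
  split_ifs <;> simp

theorem mapDer_derivative (v : Derivation ℂ K K) (f : K⟦X⟧) :
    mapDer v (d⁄dX K f) = d⁄dX K (mapDer v f) := by
  ext n
  rw [coeff_mapDer, coeff_derivative, coeff_derivative, coeff_mapDer, Derivation.leibniz]
  have : v ((n : K) + 1) = 0 := by
    rw [map_add]
    simp
  rw [this]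
  simp [mul_comm]

end Comm

/-! ### Elementary Schur polynomials and their generating series. -/

section SchurRing

variable {A : Type*} [Ring A] [Algebra ℂ A]

theorem schurS_natCast (t : ℕ+ → A) (k : ℕ) :
    schurS t (k : ℤ) = ∑ m ∈ Finset.range (k + 1),
      ((m ! : ℂ)⁻¹) • PowerSeries.coeff k (genSeries t ^ m) := by
  rw [schurS, if_neg (by omega)]
  simp

@[simp] theorem schurS_zero (t : ℕ+ → A) : schurS t 0 = 1 := by
  have := schurS_natCast t 0
  simpa using this

theorem map_schurS {B : Type*} [Ring B] [Algebra ℂ B] (f : A →ₐ[ℂ] B) (t : ℕ+ → A) (k : ℤ) :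
    f (schurS t k) = schurS (fun n => f (t n)) k := by
  have hg : PowerSeries.map (f : A →+* B) (genSeries t) = genSeries fun n => f (t n) := by
    ext n
    simp only [genSeries, coeff_map, coeff_mk]
    split_ifs <;> simp
  unfold schurS
  split_ifs
  · simp
  · rw [map_sum]
    refine Finset.sum_congr rfl fun m _ => ?_
    rw [map_smul, ← hg, ← map_pow, coeff_map]
    rfl

/-- The generating series `∑_k S_k(t) z^k`. -/
def schurGen (t : ℕ+ → A) : A⟦X⟧ := PowerSeries.mk fun k => schurS t (k : ℤ)

@[simp] theorem coeff_schurGen (t : ℕ+ → A) (k : ℕ) : coeff k (schurGen t) = schurS t (k : ℤ) := by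
  simp [schurGen]

end SchurRing

section SchurComm

variable {K : Type*} [CommRing K] [Algebra ℂ K]

theorem coeff_genSeries_succ {A : Type*} [Ring A] (t : ℕ+ → A) (n : ℕ) :
    coeff (n + 1) (genSeries t) = t n.succPNat := by
  simp [genSeries, Nat.succPNat]

@[simp] theorem constantCoeff_genSeries {A : Type*} [Ring A] (t : ℕ+ → A) :
    constantCoeff (genSeries t) = 0 := by
  simp [genSeries]

theorem coeff_genSeries_pow_of_lt {K : Type*} [CommRing K] (t : ℕ+ → K) {k m : ℕ} (h : k < m) :
    coeff k (genSeries t ^ m) = 0 := by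
  have : X ∣ genSeries t := X_dvd_iff.2 (constantCoeff_genSeries t)
  exact X_pow_dvd_iff.1 (pow_dvd_pow_of_dvd this m) k h

theorem schurS_eq_sum_range (t : ℕ+ → K) {k M : ℕ} (h : k < M) :
    schurS t (k : ℤ) = ∑ m ∈ Finset.range M, ((m ! : ℂ)⁻¹) • coeff k (genSeries t ^ m) := by
  rw [schurS_natCast]
  refine Finset.sum_subset (Finset.range_mono h) fun m _ hm => ?_
  rw [coeff_genSeries_pow_of_lt t (by simpa using hm), smul_zero]

theorem derivative_schurGen (t : ℕ+ → K) :
    d⁄dX K (schurGen t) = schurGen t * d⁄dX K (genSeries t) := by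
  ext k
  -- Truncated exponentials replace the infinite one: the terms up to degree `k + 1` determine the
  -- coefficient of `z^(k+1)`, and differentiation lowers the truncation by one.
  set E : K⟦X⟧ := ∑ m ∈ Finset.range (k + 1), ((m ! : ℂ)⁻¹) • genSeries t ^ m with hE
  have h1 : d⁄dX K (∑ m ∈ Finset.range (k + 2), ((m ! : ℂ)⁻¹) • genSeries t ^ m)
      = E * d⁄dX K (genSeries t) := by
    rw [Finset.sum_range_succ', map_add, map_sum, hE, Finset.sum_mul]
    have h0 : d⁄dX K (((0 ! : ℂ)⁻¹) • genSeries t ^ 0) = 0 := by simp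
    rw [h0, add_zero]
    refine Finset.sum_congr rfl fun m _ => ?_
    have e1 : (((m + 1)! : ℂ)⁻¹) • genSeries t ^ (m + 1)
        = C (algebraMap ℂ K (((m + 1)! : ℂ)⁻¹)) * genSeries t ^ (m + 1) := by
      ext i
      rw [coeff_C_mul, ← Algebra.smul_def]
      simp
    have e2 : ((m ! : ℂ)⁻¹) • genSeries t ^ m
        = C (algebraMap ℂ K ((m ! : ℂ)⁻¹)) * genSeries t ^ m := by
      ext i
      rw [coeff_C_mul, ← Algebra.smul_def]
      simp
    have e3 : (C (algebraMap ℂ K (((m + 1)! : ℂ)⁻¹)) : K⟦X⟧) * ((m : K⟦X⟧) + 1)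
        = C (algebraMap ℂ K ((m ! : ℂ)⁻¹)) := by
      have : ((m : K⟦X⟧) + 1) = C (algebraMap ℂ K ((m : ℂ) + 1)) := by simp
      rw [this, ← map_mul, ← map_mul, Nat.factorial_succ]
      congr 2
      have := Nat.cast_add_one_ne_zero (R := ℂ) m
      have := Nat.cast_ne_zero (R := ℂ).2 (Nat.factorial_ne_zero m)
      push_cast
      field_simp
    rw [e1, e2, Derivation.leibniz, derivative_C, derivative_pow, smul_eq_mul, smul_eq_mul,
      mul_zero, add_zero, ← e3]
    push_cast
    ring
  have h2 : coeff (k + 1) (schurGen t)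
      = coeff (k + 1) (∑ m ∈ Finset.range (k + 2), ((m ! : ℂ)⁻¹) • genSeries t ^ m) := by
    rw [coeff_schurGen, schurS_eq_sum_range t (Nat.lt_succ_self (k + 1)), map_sum]
    simp
  rw [coeff_derivative, h2, ← coeff_derivative, h1, coeff_mul, coeff_mul]
  refine Finset.sum_congr rfl fun p hp => ?_
  rw [coeff_schurGen, schurS_eq_sum_range t (M := k + 1)
    (by have := Finset.HasAntidiagonal.mem_antidiagonal.1 hp; omega), hE, map_sum]
  simp

@[simp] theorem constantCoeff_schurGen (t : ℕ+ → K) : constantCoeff (schurGen t) = 1 := by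
  rw [← coeff_zero_eq_constantCoeff_apply, coeff_schurGen]
  simp

theorem genSeries_neg {A : Type*} [Ring A] (t : ℕ+ → A) :
    genSeries (fun n => -t n) = -genSeries t := by
  ext n
  simp only [genSeries, coeff_mk, map_neg]
  split_ifs <;> simp

theorem schurGen_neg_mul (t : ℕ+ → K) : schurGen (fun n => -t n) * schurGen t = 1 := by
  refine eq_of_derivative_eq ?_ (by simp)
  rw [Derivation.leibniz, derivative_schurGen, derivative_schurGen, genSeries_neg, map_neg,
    derivative_one, smul_eq_mul, smul_eq_mul]
  ring

/-- Applying `v` to `E' = E T'`, for `E = exp T`, gives an inhomogeneous linear equation for `v E`.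
The product `E (v T)` solves the same equation with the same initial value. -/
theorem mapDer_schurGen (v : Derivation ℂ K K) (t : ℕ+ → K) :
    mapDer v (schurGen t) = schurGen t * mapDer v (genSeries t) := by
  refine eq_of_derivative_eq_mul_add (T := d⁄dX K (genSeries t))
    (R := schurGen t * d⁄dX K (mapDer v (genSeries t))) ?_ ?_ ?_
  · rw [← mapDer_derivative, derivative_schurGen, Derivation.leibniz, mapDer_derivative,
      smul_eq_mul, smul_eq_mul]
    ring
  · rw [Derivation.leibniz, derivative_schurGen, smul_eq_mul, smul_eq_mul]
    ring
  · have h (f : K⟦X⟧) : constantCoeff (mapDer v f) = v (constantCoeff f) := by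
      rw [← coeff_zero_eq_constantCoeff_apply, coeff_mapDer, coeff_zero_eq_constantCoeff_apply]
    simp [h]

end SchurComm

/-! ### Schur polynomials in commuting operators. -/

section SchurCommuting

universe u

variable {A : Type u} [Ring A] [Algebra ℂ A]

/-- Commuting elements generate a commutative subalgebra, so identities proved over commutative
rings transfer to differential operators. -/
theorem exists_schurS_eq {t : ℕ+ → A} (ht : ∀ m n, t m * t n = t n * t m) :
    ∃ (K : Type u) (_ : CommRing K) (_ : Algebra ℂ K) (f : K →ₐ[ℂ] A) (s : ℕ+ → K),
      ∀ n, f (s n) = t n := by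
  have hc : ∀ a ∈ Set.range t, ∀ b ∈ Set.range t, a * b = b * a := by
    rintro _ ⟨m, rfl⟩ _ ⟨n, rfl⟩
    exact ht m n
  have := Algebra.isMulCommutative_adjoin ℂ hc
  let : CommRing (Algebra.adjoin ℂ (Set.range t)) :=
    { (inferInstance : Ring (Algebra.adjoin ℂ (Set.range t))) with mul_comm := fun a b => this.is_comm.comm a b }
  exact ⟨Algebra.adjoin ℂ (Set.range t), inferInstance, inferInstance, (Algebra.adjoin ℂ (Set.range t)).val,
    fun n => ⟨t n, Algebra.subset_adjoin ⟨n, rfl⟩⟩, fun n => rfl⟩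

/-- This is `z E' = (z T') E` for `E = exp T`, read coefficientwise; it allows strong induction on
the index for operators. -/
theorem natCast_smul_schurS_succ {t : ℕ+ → A} (ht : ∀ m n, t m * t n = t n * t m) (b : ℕ) :
    ((b + 1 : ℕ) : ℂ) • schurS t ((b + 1 : ℕ) : ℤ) =
      ∑ p ∈ Finset.HasAntidiagonal.antidiagonal b,
        (((p.1 + 1 : ℕ) : ℂ) • t p.1.succPNat) * schurS t (p.2 : ℤ) := by
  obtain ⟨K, _, _, f, s, hs⟩ := exists_schurS_eq ht
  have h := congrArg (coeff b) (derivative_schurGen s)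
  rw [coeff_derivative, coeff_schurGen, mul_comm (schurGen s), coeff_mul] at h
  have h2 := congrArg f h
  rw [map_mul, map_schurS, map_sum] at h2
  simp only [hs] at h2
  have e : ((b + 1 : ℕ) : ℂ) • schurS t ((b + 1 : ℕ) : ℤ)
      = schurS t ((b + 1 : ℕ) : ℤ) * ((b : A) + 1) := by
    rw [Algebra.smul_def, Algebra.commutes]
    simp
  rw [e]
  have hb : f ((b : K) + 1) = (b : A) + 1 := by simp
  rw [hb] at h2
  rw [h2]
  refine Finset.sum_congr rfl fun p _ => ?_
  rw [map_mul, coeff_schurGen, map_schurS, coeff_derivative, coeff_genSeries_succ, map_mul, hs]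
  simp only [hs]
  congr 1
  rw [Algebra.smul_def, Algebra.commutes]
  simp

theorem sum_schurS_neg_mul_schurS {t : ℕ+ → A} (ht : ∀ m n, t m * t n = t n * t m) (b : ℕ) :
    ∑ p ∈ Finset.HasAntidiagonal.antidiagonal b, schurS (fun n => -t n) (p.1 : ℤ) * schurS t (p.2 : ℤ)
      = if b = 0 then 1 else 0 := by
  obtain ⟨K, _, _, f, s, hs⟩ := exists_schurS_eq ht
  have h := congrArg (fun F => f (coeff b F)) (schurGen_neg_mul s)
  simp only [coeff_mul, coeff_schurGen, map_sum, map_mul, map_schurS, map_neg, hs, coeff_one] at h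
  rw [h]
  split_ifs <;> simp

end SchurCommuting

/-! ### Division by `1 + s (q² + u q)`, with `q` acting as a shift. -/

section Hat

variable {K : Type*} [CommRing K]

/-- The coefficients of the solution `F` of `F k + s (F (k + 2) + u F (k + 1)) = c k`. -/
def hatCoeff (u : K) (c : ℕ → K⟦X⟧) : ℕ → ℕ → K
  | 0, k => coeff 0 (c k)
  | n + 1, k => coeff (n + 1) (c k) - (hatCoeff u c n (k + 2) + u * hatCoeff u c n (k + 1))

/-- The solution `F` of the system `F k + s (F (k + 2) + u F (k + 1)) = c k`, that is, the
quotient of `c` by `1 + s (q ^ 2 + u q)`, where `q` acts on sequences as the shift. -/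
def hat (u : K) (c : ℕ → K⟦X⟧) (k : ℕ) : K⟦X⟧ := PowerSeries.mk fun n => hatCoeff u c n k

theorem hat_add (u : K) (c : ℕ → K⟦X⟧) (k : ℕ) :
    hat u c k + X * (hat u c (k + 2) + C u * hat u c (k + 1)) = c k := by
  ext n
  cases n with
  | zero => simp [hat, hatCoeff, -coeff_zero_eq_constantCoeff, coeff_zero_X_mul]
  | succ n =>
    rw [map_add, coeff_succ_X_mul, map_add, coeff_C_mul]
    simp [hat, hatCoeff]

theorem eq_zero_of_hat_equation {u : K} {F : ℕ → K⟦X⟧}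
    (h : ∀ k, F k + X * (F (k + 2) + C u * F (k + 1)) = 0) (k : ℕ) : F k = 0 := by
  have key : ∀ n k, coeff n (F k) = 0 := by
    intro n
    induction n with
    | zero =>
      intro k
      simpa [-coeff_zero_eq_constantCoeff, coeff_zero_X_mul] using congrArg (coeff 0) (h k)
    | succ n ih =>
      intro k
      have := congrArg (coeff (n + 1)) (h k)
      rw [map_add, coeff_succ_X_mul, map_add, coeff_C_mul, ih, ih] at this
      simpa using this
  ext n
  simpa using key n k

/-- The factor `s` in front of the shifted terms forces uniqueness. A closed form for a quotient is
therefore proved by checking that it solves the system. -/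
theorem eq_hat {u : K} {c F : ℕ → K⟦X⟧}
    (h : ∀ k, F k + X * (F (k + 2) + C u * F (k + 1)) = c k) (k : ℕ) : F k = hat u c k := by
  refine sub_eq_zero.1 (eq_zero_of_hat_equation (u := u) (F := fun k => F k - hat u c k) ?_ k)
  intro k
  linear_combination h k - hat_add u c k

theorem hat_shift (u : K) (c : ℕ → K⟦X⟧) (i k : ℕ) :
    hat u (fun m => c (m + i)) k = hat u c (k + i) := by
  refine (eq_hat (F := fun k => hat u c (k + i)) (fun k => ?_) k).symm
  have := hat_add u c (k + i)
  rwa [show k + i + 2 = k + 2 + i by ring, show k + i + 1 = k + 1 + i by ring] at this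

/-- With `w = q² + u q`, this is `d/ds (1 + s w)⁻¹ = -w (1 + s w)⁻²`; a double `hat` is division by
the square. -/
theorem hat_const_derivative (u : K) (c : ℕ → K) (k : ℕ) :
    d⁄dX K (hat u (fun m => C (c m)) k) =
      -(hat u (hat u fun m => C (c m)) (k + 2) + C u * hat u (hat u fun m => C (c m)) (k + 1)) := by
  set F := hat u fun m => C (c m)
  have hF : ∀ k, F k + X * (F (k + 2) + C u * F (k + 1)) = C (c k) := hat_add u _
  have hFF : ∀ k, hat u F k + X * (hat u F (k + 2) + C u * hat u F (k + 1)) = F k := hat_add u _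
  refine sub_eq_zero.1 (eq_zero_of_hat_equation (u := u)
    (F := fun k => d⁄dX K (F k) - -(hat u F (k + 2) + C u * hat u F (k + 1))) ?_ k)
  intro k
  have h1 := congrArg (d⁄dX K) (hF k)
  simp only [map_add, Derivation.leibniz, derivative_X, derivative_C, smul_eq_mul] at h1
  linear_combination h1 + hFF (k + 2) + C u * hFF (k + 1)

/-- The binomial sum `∑_i C(n, i) u ^ (n - i) c (k + n + i)`. -/
def binomSum (u : K) (c : ℕ → K) (n k : ℕ) : K :=
  ∑ i ∈ Finset.range (n + 1), (n.choose i : K) * u ^ (n - i) * c (k + n + i)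

/-- `binomSum` is `w^n = (q² + u q)^n` applied to `c`, and one more factor `w` is Pascal's rule. -/
theorem binomSum_succ (u : K) (c : ℕ → K) (n k : ℕ) :
    binomSum u c (n + 1) k = binomSum u c n (k + 2) + u * binomSum u c n (k + 1) := by
  unfold binomSum
  rw [Finset.sum_range_succ']
  have h1 : ∀ i ∈ Finset.range (n + 1),
      ((n + 1).choose (i + 1) : K) * u ^ (n + 1 - (i + 1)) * c (k + (n + 1) + (i + 1))
      = (n.choose i : K) * u ^ (n - i) * c (k + 2 + n + i)
        + (n.choose (i + 1) : K) * u ^ (n - i) * c (k + 2 + n + i) := by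
    intro i _
    rw [Nat.choose_succ_succ, Nat.add_sub_add_right,
      show k + (n + 1) + (i + 1) = k + 2 + n + i by ring]
    push_cast
    ring
  rw [Finset.sum_congr rfl h1, Finset.sum_add_distrib, add_assoc]
  congr 1
  rw [Finset.sum_range_succ, Finset.sum_range_succ' _ n, mul_add, Finset.mul_sum]
  simp only [Nat.choose_succ_self, Nat.cast_zero, zero_mul, add_zero, Nat.choose_zero_right,
    Nat.cast_one, one_mul, Nat.sub_zero]
  congr 1
  · refine Finset.sum_congr rfl fun i hi => ?_
    have : n - i = n - (i + 1) + 1 := by have := Finset.mem_range.1 hi; omega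
    rw [this, pow_succ, show k + 2 + n + i = k + 1 + n + (i + 1) by ring]
    ring
  · rw [pow_succ, show k + (n + 1) = k + 1 + n by ring]
    ring

theorem coeff_hat_const (u : K) (c : ℕ → K) (n k : ℕ) :
    coeff n (hat u (fun m => C (c m)) k) = (-1) ^ n * binomSum u c n k := by
  induction n generalizing k with
  | zero => simp [hat, hatCoeff, binomSum, -coeff_zero_eq_constantCoeff]
  | succ n ih =>
    have := congrArg (coeff (n + 1)) (hat_add u (fun m => C (c m)) k)
    rw [map_add, coeff_succ_X_mul, map_add, coeff_C_mul, ih, ih, coeff_C, if_neg (by omega)] at this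
    rw [binomSum_succ]
    linear_combination this

/-- If `e` is the quotient of `g` by `1 + s (q ^ 2 + u q)`, expanded in powers of `q`, then
pairing `e` with a sequence `c` amounts to multiplying `g` by `hat u c`. -/
theorem sum_mul_eq_coeff_hat_mul {u : K} {G : K⟦X⟧} {e : ℕ → ℕ → K}
    (h0 : ∀ l, e l 0 = coeff l G) (h1 : ∀ b, e 0 (b + 1) = 0)
    (h2 : ∀ l, e (l + 1) 1 = -(u * e l 0))
    (h3 : ∀ l b, e (l + 1) (b + 2) = -(u * e l (b + 1)) - e l b)
    (c : ℕ → K) (l k B : ℕ) (hB : 2 * l + 1 ≤ B) :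
    ∑ b ∈ Finset.range B, c (b + k) * e l b = coeff l (hat u (fun m => C (c m)) k * G) := by
  induction l generalizing k B with
  | zero =>
    obtain ⟨B, rfl⟩ : ∃ B', B = B' + 1 := ⟨B - 1, by omega⟩
    rw [Finset.sum_range_succ', Finset.sum_eq_zero (fun b _ => by rw [h1, mul_zero]), h0]
    simp [hat, hatCoeff]
  | succ l ih =>
    -- Each power of `s` raises the degree in `q` by at most two, which explains the bound `2 * l +
    -- 1`.
    obtain ⟨B, rfl⟩ : ∃ B', B = B' + 2 := ⟨B - 2, by omega⟩
    have hs := congrArg (fun F => coeff (l + 1) (F * G)) (hat_add u (fun m => C (c m)) k)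
    simp only [add_mul, mul_assoc, map_add, coeff_succ_X_mul, coeff_C_mul] at hs
    rw [← ih (k + 2) B (by omega), ← ih (k + 1) (B + 1) (by omega)] at hs
    rw [Finset.sum_range_succ'] at hs
    rw [Finset.sum_range_succ', Finset.sum_range_succ', h2, h0 (l + 1)]
    have e1 : ∀ b ∈ Finset.range B, c (b + 1 + 1 + k) * e (l + 1) (b + 1 + 1)
        = -(u * (c (b + 1 + (k + 1)) * e l (b + 1))) - c (b + (k + 2)) * e l b := by
      intro b _
      rw [h3, show b + 1 + (k + 1) = b + 1 + 1 + k by ring, show b + (k + 2) = b + 1 + 1 + k by ring]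
      ring
    rw [Finset.sum_congr rfl e1, Finset.sum_sub_distrib, Finset.sum_neg_distrib, ← Finset.mul_sum]
    rw [show 0 + (k + 1) = 0 + 1 + k by ring] at hs
    rw [show 0 + k = k from zero_add k]
    linear_combination -hs

end Hat

/-! ### Logarithmic derivatives of `exp (log (1 + s w))`. -/

section Identities

variable {K : Type*} [CommRing K] [Algebra ℂ K]

/-- The Schur arguments `(-1) ^ (n - 1) λ_n / n`, where `λ_n = ∑_i C(n, i) u ^ (n - i) c (n + i)`. -/
def lamArg (u : K) (c : ℕ → K) (n : ℕ+) : K :=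
  ((-1 : ℂ) ^ ((n : ℕ) + 1) / ((n : ℕ) : ℂ)) • binomSum u c n 0

/-- This is `d/ds log (1 + s w) = w / (1 + s w)`. Since the sequence starts at `c 1`, index `0`
stands for `q` and index `1` for `q²`. -/
theorem derivative_genSeries_lamArg (u : K) (c : ℕ → K) :
    d⁄dX K (genSeries (lamArg u c)) =
      hat u (fun m => C (c (m + 1))) 1 + C u * hat u (fun m => C (c (m + 1))) 0 := by
  rw [hat_shift u (fun m => C (c m)) 1, hat_shift u (fun m => C (c m)) 1]
  ext n
  rw [coeff_derivative, coeff_genSeries_succ, map_add, coeff_C_mul, coeff_hat_const,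
    coeff_hat_const, lamArg]
  have h := binomSum_succ u c n 0
  simp only [zero_add] at h
  have e : ((Nat.succPNat n : ℕ+) : ℕ) = n + 1 := rfl
  rw [e, h, Algebra.smul_def]
  have e2 : ((n : K) + 1) = algebraMap ℂ K ((n : ℂ) + 1) := by simp
  have e3 : algebraMap ℂ K ((-1 : ℂ) ^ (n + 1 + 1) / ((n + 1 : ℕ) : ℂ)) * ((n : K) + 1)
      = (-1) ^ n := by
    have := Nat.cast_add_one_ne_zero (R := ℂ) n
    have e4 : (-1 : ℂ) ^ (n + 1 + 1) / ((n + 1 : ℕ) : ℂ) * ((n : ℂ) + 1) = (-1) ^ n := by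
      rw [Nat.cast_add_one, div_mul_cancel₀ _ this, pow_succ, pow_succ]
      ring
    rw [e2, ← map_mul, e4]
    simp
  linear_combination (binomSum u c n 2 + u * binomSum u c n 1) * e3

theorem derivative_schurGen_lamArg (u : K) (c : ℕ → K) :
    d⁄dX K (schurGen (lamArg u c)) = schurGen (lamArg u c) *
      (hat u (fun m => C (c (m + 1))) 1 + C u * hat u (fun m => C (c (m + 1))) 0) := by
  rw [derivative_schurGen, derivative_genSeries_lamArg]

/-- A derivation with `c b ↦ b * d b` acts like `q ∂_q`, while `u ↦ e` contributes `e ∂_u`. On `log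
(1 + s w)` these produce `s (2 q² + u q) / (1 + s w)` and `s e q / (1 + s w)`. -/
theorem mapDer_schurGen_lamArg {u : K} {c : ℕ → K} (v : Derivation ℂ K K) {e : K} {d : ℕ → K}
    (hu : v u = e) (hc : ∀ b, v (c b) = b * d b) :
    mapDer v (schurGen (lamArg u c)) = schurGen (lamArg u c) *
      (X * (C e * hat u (fun m => C (c (m + 1))) 0 +
        2 * hat u (fun m => C (d (m + 1))) 1 + C u * hat u (fun m => C (d (m + 1))) 0)) := by
  rw [mapDer_schurGen]
  congr 1
  have hP' := hat_const_derivative u fun m => c (m + 1)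
  have hJ' := hat_const_derivative u fun m => d (m + 1)
  set P := hat u fun m => C (c (m + 1)) with hPdef
  set J := hat u fun m => C (d (m + 1)) with hJdef
  have hP : ∀ k, P k + X * (P (k + 2) + C u * P (k + 1)) = C (c (k + 1)) := hat_add u _
  have hJ : ∀ k, J k + X * (J (k + 2) + C u * J (k + 1)) = C (d (k + 1)) := hat_add u _
  have hPP : ∀ k, hat u P k + X * (hat u P (k + 2) + C u * hat u P (k + 1)) = P k := hat_add u _
  have hJJ : ∀ k, hat u J k + X * (hat u J (k + 2) + C u * hat u J (k + 1)) = J k := hat_add u _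
  -- Quotient rule for `q^(m+1) / (1 + s w)`: `q ∂_q` of the numerator gives the factor `m + 1`, and
  -- the denominator gives the double quotients.
  have hv : ∀ m, mapDer v (P m) = -(X * (C e * hat u P (m + 1))) + ((m : K⟦X⟧) + 1) * J m
      - X * (2 * hat u J (m + 2) + C u * hat u J (m + 1)) := by
    intro m
    refine sub_eq_zero.1 (eq_zero_of_hat_equation (u := u) (F := fun m => mapDer v (P m) -
      (-(X * (C e * hat u P (m + 1))) + ((m : K⟦X⟧) + 1) * J m
      - X * (2 * hat u J (m + 2) + C u * hat u J (m + 1)))) ?_ m)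
    intro k
    have h1 := congrArg (mapDer v) (hP k)
    simp only [map_add, Derivation.leibniz, mapDer_X, mapDer_C, smul_eq_mul, hu, hc] at h1
    have h2 : (C (((k + 1 : ℕ) : K) * d (k + 1)) : K⟦X⟧) = ((k : K⟦X⟧) + 1) * C (d (k + 1)) := by
      simp
    rw [h2] at h1
    push_cast
    linear_combination h1 + X * C e * hPP (k + 1) - ((k : K⟦X⟧) + 1) * hJ k
      + X * (2 * hJJ (k + 2) + C u * hJJ (k + 1))
  refine eq_of_derivative_eq ?_ ?_
  · rw [← mapDer_derivative, derivative_genSeries_lamArg]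
    simp only [map_add, Derivation.leibniz, derivative_X, derivative_C, mapDer_C, smul_eq_mul, hv,
      hP', hJ', hu, ← hPdef]
    have h2 : d⁄dX K (2 : K⟦X⟧) = 0 := by
      rw [show (2 : K⟦X⟧) = C 2 from (map_ofNat C 2).symm, derivative_C]
    rw [h2]
    push_cast
    ring
  · simp [← PowerSeries.coeff_zero_eq_constantCoeff_apply, -coeff_zero_eq_constantCoeff,
      coeff_zero_X_mul, genSeries]

end Identities

/-! ### Pairing the inverse shift with multiplication operators and derivations. -/

section Pairing

variable {K : Type*} [CommRing K] {u : K} {c S : ℕ → K}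

/-- The quotient of `∑_a S_a c (k + 2 - a)` by `1 + s (q ^ 2 + u q)`. -/
theorem hat_sum_mul (k : ℕ) :
    hat u (fun k => C (∑ a ∈ Finset.range (k + 2), S a * c (k + 2 - a))) k =
      ∑ a ∈ Finset.range (k + 2), C (S a) * hat u (fun m => C (c (m + 1))) (k + 1 - a)
      - X * hat u (fun m => C (c (m + 1))) 0 * hat u (fun m => C (S (m + 1))) (k + 2)
      - X * (hat u (fun m => C (c (m + 1))) 1 + C u * hat u (fun m => C (c (m + 1))) 0)
        * hat u (fun m => C (S (m + 1))) (k + 1) := by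
  set P := hat u fun m => C (c (m + 1)) with hPdef
  set J := hat u fun m => C (S (m + 1)) with hJdef
  have hP : ∀ k, P k + X * (P (k + 2) + C u * P (k + 1)) = C (c (k + 1)) := hat_add u _
  have hJ : ∀ k, J k + X * (J (k + 2) + C u * J (k + 1)) = C (S (k + 1)) := hat_add u _
  refine (eq_hat (F := fun k => ∑ a ∈ Finset.range (k + 2), C (S a) * P (k + 1 - a)
      - X * P 0 * J (k + 2) - X * (P 1 + C u * P 0) * J (k + 1)) (fun k => ?_) k).symm
  have s1 : ∑ a ∈ Finset.range (k + 1 + 2), C (S a) * P (k + 1 + 1 - a)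
      = ∑ a ∈ Finset.range (k + 2), C (S a) * P (k + 1 - a + 1) + C (S (k + 2)) * P 0 := by
    rw [Finset.sum_range_succ]
    congr 1
    · refine Finset.sum_congr rfl fun a ha => ?_
      rw [show k + 1 + 1 - a = k + 1 - a + 1 by have := Finset.mem_range.1 ha; omega]
    · simp
  have s2 : ∑ a ∈ Finset.range (k + 2 + 2), C (S a) * P (k + 2 + 1 - a)
      = ∑ a ∈ Finset.range (k + 2), C (S a) * P (k + 1 - a + 2) + C (S (k + 2)) * P 1
        + C (S (k + 3)) * P 0 := by
    rw [Finset.sum_range_succ, Finset.sum_range_succ]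
    congr 1
    · congr 1
      · refine Finset.sum_congr rfl fun a ha => ?_
        rw [show k + 2 + 1 - a = k + 1 - a + 2 by have := Finset.mem_range.1 ha; omega]
      · rw [show k + 2 + 1 - (k + 2) = 1 by omega]
    · simp
  have s3 : C (∑ a ∈ Finset.range (k + 2), S a * c (k + 2 - a))
      = ∑ a ∈ Finset.range (k + 2), C (S a) * P (k + 1 - a)
        + X * (∑ a ∈ Finset.range (k + 2), C (S a) * P (k + 1 - a + 2)
        + C u * ∑ a ∈ Finset.range (k + 2), C (S a) * P (k + 1 - a + 1)) := by
    rw [map_sum, Finset.mul_sum, ← Finset.sum_add_distrib, Finset.mul_sum,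
      ← Finset.sum_add_distrib]
    refine Finset.sum_congr rfl fun a ha => ?_
    have := hP (k + 1 - a)
    rw [show k + 1 - a + 1 = k + 2 - a by have := Finset.mem_range.1 ha; omega] at this ⊢
    rw [map_mul]
    linear_combination (- C (S a)) * this
  rw [s1, s2, s3]
  linear_combination (- X * P 0) * hJ (k + 2) - X * (P 1 + C u * P 0) * hJ (k + 1)

/-- The analogue of `sum_mul_eq_coeff_hat_mul` for a sequence of derivations. -/
theorem sum_der_eq_coeff [Algebra ℂ K] {G : K⟦X⟧} {e : ℕ → ℕ → K} {v : ℕ → Derivation ℂ K K} {y : ℕ → K⟦X⟧}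
    (h0 : ∀ l, e l 0 = coeff l G) (h1 : ∀ b, e 0 (b + 1) = 0)
    (h2 : ∀ l, e (l + 1) 1 = -(u * e l 0))
    (h3 : ∀ l b, e (l + 1) (b + 2) = -(u * e l (b + 1)) - e l b)
    (hv : ∀ b, v b u = S (b + 3))
    (hy : ∀ k, y k + X * (y (k + 2) + C u * y (k + 1)) =
      mapDer (v k) G - X * (hat u (fun m => C (S (m + 1))) (k + 3) * G))
    (l k B : ℕ) (hB : 2 * l + 1 ≤ B) :
    ∑ b ∈ Finset.range B, v (b + k) (e l b) = coeff l (y k) := by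
  induction l generalizing k B with
  | zero =>
    obtain ⟨B, rfl⟩ : ∃ B', B = B' + 1 := ⟨B - 1, by omega⟩
    rw [Finset.sum_range_succ', Finset.sum_eq_zero (fun b _ => by rw [h1, map_zero]), h0]
    have := congrArg (coeff 0) (hy k)
    simp only [map_add, map_sub, coeff_zero_X_mul, coeff_mapDer] at this
    simp only [zero_add, add_zero, sub_zero] at this ⊢
    exact this.symm
  | succ l ih =>
    obtain ⟨B, rfl⟩ : ∃ B', B = B' + 2 := ⟨B - 2, by omega⟩
    have hs := congrArg (coeff (l + 1)) (hy k)
    simp only [map_add, map_sub, coeff_succ_X_mul, coeff_C_mul, coeff_mapDer] at hs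
    have hp := sum_mul_eq_coeff_hat_mul h0 h1 h2 h3 (fun m => S (m + 1)) l (k + 3) (B + 1) (by omega)
    rw [← ih (k + 2) B (by omega), ← ih (k + 1) (B + 1) (by omega), ← hp] at hs
    rw [Finset.sum_range_succ', Finset.sum_range_succ' _ B] at hs
    rw [Finset.sum_range_succ', Finset.sum_range_succ', h2, h0 (l + 1)]
    -- The derivations do not commute with `u`. The Leibniz term `v u = S (b + 3)`, with its shifted
    -- index, accounts for the quotient subtracted in `hy`.
    have e1 : ∀ b ∈ Finset.range B, v (b + 1 + 1 + k) (e (l + 1) (b + 1 + 1))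
        = -(u * v (b + 1 + (k + 1)) (e l (b + 1))) - S (b + 1 + (k + 3) + 1) * e l (b + 1)
          - v (b + (k + 2)) (e l b) := by
      intro b _
      rw [h3, show b + 1 + (k + 1) = b + 1 + 1 + k by ring, show b + (k + 2) = b + 1 + 1 + k by ring,
        map_sub, map_neg, Derivation.leibniz, hv, smul_eq_mul, smul_eq_mul,
        show b + 1 + 1 + k + 3 = b + 1 + (k + 3) + 1 by ring]
      ring
    rw [Finset.sum_congr rfl e1, Finset.sum_sub_distrib, Finset.sum_sub_distrib,
      Finset.sum_neg_distrib, ← Finset.mul_sum]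
    rw [map_neg, Derivation.leibniz, hv, smul_eq_mul, smul_eq_mul]
    rw [show 0 + (k + 1) = 0 + 1 + k by ring] at hs
    rw [show 0 + 1 + k + 3 = 0 + (k + 3) + 1 by ring]
    rw [show 0 + k = k from zero_add k]
    linear_combination -hs

end Pairing

section HatLinear

variable {K : Type*} [CommRing K]

theorem coeff_zero_mul_eq (f g : K⟦X⟧) : coeff 0 (f * g) = coeff 0 f * coeff 0 g := by
  simp

theorem coeff_zero_hat (u : K) (c : ℕ → K⟦X⟧) (k : ℕ) : coeff 0 (hat u c k) = coeff 0 (c k) := by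
  rw [hat, coeff_mk, hatCoeff]

theorem mul_hat (u : K) (f : K⟦X⟧) (c : ℕ → K⟦X⟧) (k : ℕ) :
    f * hat u c k = hat u (fun m => f * c m) k :=
  eq_hat (F := fun k => f * hat u c k) (fun k => by linear_combination f * hat_add u c k) k

theorem hat_add_seq (u : K) (c d : ℕ → K⟦X⟧) (k : ℕ) :
    hat u (fun m => c m + d m) k = hat u c k + hat u d k :=
  (eq_hat (F := fun k => hat u c k + hat u d k)
    (fun k => by linear_combination hat_add u c k + hat_add u d k) k).symm

/-- `hat` is linear over power series in `s`, so the pairing with constant sequences extends to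
sequences of series. -/
theorem sum_coeff_hat_mul (u : K) (d : ℕ → K⟦X⟧) (G : K⟦X⟧) (n k : ℕ) :
    ∑ p ∈ Finset.HasAntidiagonal.antidiagonal n,
      coeff p.2 (hat u (fun b => C (coeff p.1 (d b))) k * G) = coeff n (hat u d k * G) := by
  induction n generalizing k with
  | zero =>
    simp only [Finset.Nat.antidiagonal_zero, Finset.sum_singleton, coeff_zero_mul_eq,
      coeff_zero_hat]
    simp
  | succ n ih =>
    have hs := congrArg (fun F => coeff (n + 1) (F * G)) (hat_add u d k)
    simp only [add_mul, mul_assoc, map_add, coeff_succ_X_mul, coeff_C_mul] at hs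
    rw [coeff_mul _ (d k), Finset.Nat.sum_antidiagonal_succ', ← ih, ← ih] at hs
    rw [Finset.Nat.sum_antidiagonal_succ']
    have e1 : ∀ p ∈ Finset.HasAntidiagonal.antidiagonal n,
        coeff (p.2 + 1) (hat u (fun b => C (coeff p.1 (d b))) k * G)
        = coeff p.1 (d k) * coeff (p.2 + 1) G
          - coeff p.2 (hat u (fun b => C (coeff p.1 (d b))) (k + 2) * G)
          - u * coeff p.2 (hat u (fun b => C (coeff p.1 (d b))) (k + 1) * G) := by
      intro p _
      have hs := congrArg (fun F => coeff (p.2 + 1) (F * G))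
        (hat_add u (fun b => C (coeff p.1 (d b))) k)
      simp only [add_mul, mul_assoc, map_add, coeff_succ_X_mul, coeff_C_mul] at hs
      linear_combination hs
    have e0 : coeff 0 (hat u (fun b => C (coeff (n + 1) (d b))) k * G)
        = coeff (n + 1) (d k) * coeff 0 G := by
      rw [coeff_zero_mul_eq, coeff_zero_hat]
      simp
    rw [Finset.sum_congr rfl e1, Finset.sum_sub_distrib, Finset.sum_sub_distrib, ← Finset.mul_sum]
    simp only at e0 ⊢
    rw [e0]
    linear_combination -hs

end HatLinear

/-! ### The action of `φ*_{-1}`, in abstract form. -/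

section Action

variable {K : Type*} [CommRing K] [Algebra ℂ K] {u : K} {c S N : ℕ → K}
  {v : ℕ → Derivation ℂ K K} {e : ℕ → ℕ → K}

/-- This is `φ*_{-1}` on the coefficients of `G` alone. The multiplication part is `hat_sum_mul`,
the derivation part is `sum_der_eq_coeff`, and their sum collapses to derivatives in `s`. -/
theorem sum_alpha_eq_coeff (hS0 : S 0 = 1) (hS1 : S 1 = u) (hu : ∀ b, v b u = S (b + 3))
    (hc : ∀ b m, v b (c m) = m * S (m + b + 2))
    (h0 : ∀ l, e l 0 = coeff l (schurGen (lamArg u c))) (h1 : ∀ b, e 0 (b + 1) = 0)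
    (h2 : ∀ l, e (l + 1) 1 = -(u * e l 0))
    (h3 : ∀ l b, e (l + 1) (b + 2) = -(u * e l (b + 1)) - e l b)
    (l B : ℕ) (hB : 2 * l + 1 ≤ B) :
    ∑ b ∈ Finset.range B, ((∑ a ∈ Finset.range (b + 2), S a * c (b + 2 - a)) * e l b
        + v b (e l b))
      = coeff l (d⁄dX K (schurGen (lamArg u c)) -
        X * d⁄dX K (hat u (fun m => C (S (m + 1))) 1 * schurGen (lamArg u c))) := by
  have hkey := hat_sum_mul (u := u) (c := c) (S := S) 0
  have hJ' := hat_const_derivative u (fun m => S (m + 1)) 1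
  have hG' := derivative_schurGen_lamArg u c
  set P := hat u fun m => C (c (m + 1)) with hPdef
  set J := hat u fun m => C (S (m + 1)) with hJdef
  set G := schurGen (lamArg u c) with hG
  have hJ : ∀ k, J k + X * (J (k + 2) + C u * J (k + 1)) = C (S (k + 1)) := hat_add u _
  have hJJ : ∀ k, hat u J k + X * (hat u J (k + 2) + C u * hat u J (k + 1)) = J k := hat_add u _
  -- After `s J_{k+3} G` is subtracted from `v_k G`, the source is `s G (S_{k+3} P_0 + J_{k+3} + u
  -- J_{k+2})`. Dividing it by `1 + s w` termwise gives the candidate verified here.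
  have hy : ∀ k, G * (X * P 0 * J (k + 2) + X * (hat u J (k + 3) + C u * hat u J (k + 2)))
      + X * (G * (X * P 0 * J (k + 2 + 2) + X * (hat u J (k + 2 + 3) + C u * hat u J (k + 2 + 2)))
        + C u * (G * (X * P 0 * J (k + 1 + 2) +
          X * (hat u J (k + 1 + 3) + C u * hat u J (k + 1 + 2)))))
      = mapDer (v k) G - X * (J (k + 3) * G) := by
    intro k
    rw [hG, mapDer_schurGen_lamArg (v k) (hu k) (d := fun b => S (b + k + 2)) (hc k), ← hG, ← hPdef]
    have hsh : ∀ i, hat u (fun m => C (S (m + 1 + k + 2))) i = J (i + (k + 2)) := by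
      intro i
      rw [hJdef, ← hat_shift u (fun m => C (S (m + 1))) (k + 2)]
      congr 1
      funext m
      rw [show m + 1 + k + 2 = m + (k + 2) + 1 by ring]
    rw [hsh, hsh, show 1 + (k + 2) = k + 3 by ring, show 0 + (k + 2) = k + 2 by ring]
    linear_combination G * X * P 0 * hJ (k + 2) + G * X * hJJ (k + 3) + G * X * C u * hJJ (k + 2)
  have t1 := sum_mul_eq_coeff_hat_mul h0 h1 h2 h3
    (fun k => ∑ a ∈ Finset.range (k + 2), S a * c (k + 2 - a)) l 0 B hB
  have t2 := sum_der_eq_coeff h0 h1 h2 h3 hu (y := fun k =>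
    G * (X * P 0 * J (k + 2) + X * (hat u J (k + 3) + C u * hat u J (k + 2)))) hy l 0 B hB
  simp only [add_zero] at t1 t2
  rw [Finset.sum_add_distrib, t1, t2, ← map_add]
  congr 1
  rw [hkey, Derivation.leibniz, hG', hJ', smul_eq_mul, smul_eq_mul, Finset.sum_range_succ,
    Finset.sum_range_succ, Finset.sum_range_zero, hS0, hS1, map_one]
  simp only [Nat.reduceAdd, Nat.sub_self, Nat.sub_zero]
  ring

/-- This is the correction caused by the derivations acting on `Q`. The convolution sums `M`
telescope in `m`, and the final identification is the coefficient `m + 2` of the relation between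
`S` and its inverse `N`. -/
theorem hat_der_schur (hS0 : S 0 = 1) (hS1 : S 1 = u) (hu : ∀ b, v b u = S (b + 3))
    (hSN : ∀ m, ∑ i ∈ Finset.range (m + 2), S i * N (m + 1 - i) = 0)
    (hN : ∀ b m, v b (N m) = N m * S (b + 2)
      - ∑ i ∈ Finset.range (m + 1), S (i + b + 2) * N (m - i)) (m : ℕ) :
    hat u (fun b => mapDer (v b) (C (N m) + X * C (N (m + 2) + u * N (m + 1)))) 0
      = C (N (m + 2) + u * N (m + 1)) + C (N m) * hat u (fun m => C (S (m + 1))) 1 := by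
  set J := hat u fun m => C (S (m + 1)) with hJdef
  have hJ : ∀ k, J k + X * (J (k + 2) + C u * J (k + 1)) = C (S (k + 1)) := hat_add u _
  set M : ℕ → ℕ → K⟦X⟧ := fun m =>
    hat u (fun b => C (∑ i ∈ Finset.range (m + 1), S (i + b + 2) * N (m - i))) with hMdef
  have hM : ∀ m k, M m k + X * (M m (k + 2) + C u * M m (k + 1))
      = C (∑ i ∈ Finset.range (m + 1), S (i + k + 2) * N (m - i)) := fun m => hat_add u _
  have hV : ∀ m k, hat u (fun b => C (v b (N m))) k = C (N m) * J (k + 1) - M m k := by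
    intro m k
    refine (eq_hat (F := fun k => C (N m) * J (k + 1) - M m k) (fun k => ?_) k).symm
    rw [hN, map_sub, map_mul]
    linear_combination C (N m) * hJ (k + 1) - hM m k
  have hMs : ∀ m k, M (m + 1) k = C (N (m + 1)) * J (k + 1) + M m (k + 1) := by
    intro m k
    refine (eq_hat (F := fun k => C (N (m + 1)) * J (k + 1) + M m (k + 1)) (fun k => ?_) k).symm
    rw [Finset.sum_range_succ', map_add]
    have e1 : ∀ i ∈ Finset.range (m + 1), S (i + 1 + k + 2) * N (m + 1 - (i + 1))
        = S (i + (k + 1) + 2) * N (m - i) := by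
      intro i _
      rw [Nat.add_sub_add_right, show i + 1 + k + 2 = i + (k + 1) + 2 by ring]
    rw [Finset.sum_congr rfl e1, map_mul, zero_add, Nat.sub_zero]
    linear_combination C (N (m + 1)) * hJ (k + 1) + hM m (k + 1)
  have hsplit : (fun b => mapDer (v b) (C (N m) + X * C (N (m + 2) + u * N (m + 1))))
      = fun b => C (v b (N m)) + X * (C (v b (N (m + 2))) + (C u * C (v b (N (m + 1)))
        + C (N (m + 1)) * C (S (b + 3)))) := by
    funext b
    simp only [map_add, Derivation.leibniz, mapDer_X, mapDer_C, smul_eq_mul, hu, map_mul]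
    ring
  have hJ2 : hat u (fun b => C (S (b + 3))) 0 = J 2 := by
    have := hat_shift u (fun m => C (S (m + 1))) 2 0
    exact this
  rw [hsplit, hat_add_seq, ← mul_hat, hat_add_seq, hat_add_seq, ← mul_hat, ← mul_hat, hV, hV, hV,
    hJ2, hMs, hMs, hMs]
  have hf := hM m 0
  have hs := hSN (m + 1)
  rw [Finset.sum_range_succ', Finset.sum_range_succ', hS0] at hs
  have e1 : ∀ i ∈ Finset.range (m + 1), S (i + 1 + 1) * N (m + 1 + 1 - (i + 1 + 1))
      = S (i + 0 + 2) * N (m - i) := by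
    intro i _
    rw [Nat.add_sub_add_right, Nat.add_sub_add_right]
  rw [Finset.sum_congr rfl e1, zero_add, hS1] at hs
  have hs' := congrArg (C : K →+* K⟦X⟧) hs
  simp only [Nat.sub_zero, Nat.add_sub_cancel, map_add, map_mul, map_zero, map_one] at hs' ⊢
  simp only [zero_add, Nat.reduceAdd] at hf hs' ⊢
  linear_combination -hf - hs'

/-- Multiplication by `f = Q^n` adds to `sum_alpha_eq_coeff` the term where the derivations hit `f`.
Using `N_m = Q - s κ`, the total becomes `(f G)' - s (f J_1 G)' + n f J_1 G`. The last two terms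
cancel only in the coefficient of `s^n`, which is why the exponent of `Q` must equal the index
extracted. -/
theorem sum_alpha_coeff_mul (hS0 : S 0 = 1) (hS1 : S 1 = u) (hu : ∀ b, v b u = S (b + 3))
    (hc : ∀ b m, v b (c m) = m * S (m + b + 2))
    (hSN : ∀ m, ∑ i ∈ Finset.range (m + 2), S i * N (m + 1 - i) = 0)
    (hN : ∀ b m, v b (N m) = N m * S (b + 2)
      - ∑ i ∈ Finset.range (m + 1), S (i + b + 2) * N (m - i))
    (h0 : ∀ l, e l 0 = coeff l (schurGen (lamArg u c))) (h1 : ∀ b, e 0 (b + 1) = 0)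
    (h2 : ∀ l, e (l + 1) 1 = -(u * e l 0))
    (h3 : ∀ l b, e (l + 1) (b + 2) = -(u * e l (b + 1)) - e l b)
    (m n B : ℕ) (hB : 2 * n + 1 ≤ B) (f : K⟦X⟧)
    (hf : f = (C (N m) + X * C (N (m + 2) + u * N (m + 1))) ^ n) :
    ∑ b ∈ Finset.range B, ((∑ a ∈ Finset.range (b + 2), S a * c (b + 2 - a)) *
        (∑ p ∈ Finset.HasAntidiagonal.antidiagonal n, coeff p.1 f * e p.2 b)
        + v b (∑ p ∈ Finset.HasAntidiagonal.antidiagonal n, coeff p.1 f * e p.2 b))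
      = ((n : K) + 1) * coeff (n + 1) (f * schurGen (lamArg u c)) := by
  set G := schurGen (lamArg u c) with hG
  set J := hat u fun m => C (S (m + 1)) with hJdef
  have hle : ∀ p ∈ Finset.HasAntidiagonal.antidiagonal n, 2 * p.2 + 1 ≤ B := by
    intro p hp
    have := Finset.HasAntidiagonal.mem_antidiagonal.1 hp
    omega
  have step : ∀ b, (∑ a ∈ Finset.range (b + 2), S a * c (b + 2 - a)) *
        (∑ p ∈ Finset.HasAntidiagonal.antidiagonal n, coeff p.1 f * e p.2 b)
        + v b (∑ p ∈ Finset.HasAntidiagonal.antidiagonal n, coeff p.1 f * e p.2 b)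
      = ∑ p ∈ Finset.HasAntidiagonal.antidiagonal n,
        (coeff p.1 f * ((∑ a ∈ Finset.range (b + 2), S a * c (b + 2 - a)) * e p.2 b + v b (e p.2 b))
          + coeff p.1 (mapDer (v b) f) * e p.2 b) := by
    intro b
    rw [Finset.mul_sum, map_sum, ← Finset.sum_add_distrib]
    refine Finset.sum_congr rfl fun p _ => ?_
    rw [Derivation.leibniz, coeff_mapDer, smul_eq_mul, smul_eq_mul]
    ring
  rw [Finset.sum_congr rfl fun b _ => step b, Finset.sum_comm]
  have step2 : ∀ p ∈ Finset.HasAntidiagonal.antidiagonal n, ∑ b ∈ Finset.range B,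
        (coeff p.1 f * ((∑ a ∈ Finset.range (b + 2), S a * c (b + 2 - a)) * e p.2 b + v b (e p.2 b))
          + coeff p.1 (mapDer (v b) f) * e p.2 b)
      = coeff p.1 f * coeff p.2 (d⁄dX K G - X * d⁄dX K (J 1 * G))
        + coeff p.2 (hat u (fun b => C (coeff p.1 (mapDer (v b) f))) 0 * G) := by
    intro p hp
    rw [Finset.sum_add_distrib, ← Finset.mul_sum,
      sum_alpha_eq_coeff hS0 hS1 hu hc h0 h1 h2 h3 p.2 B (hle p hp),
      ← sum_mul_eq_coeff_hat_mul h0 h1 h2 h3 (fun b => coeff p.1 (mapDer (v b) f)) p.2 0 B (hle p hp)]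
    rfl
  rw [Finset.sum_congr rfl step2, Finset.sum_add_distrib, ← coeff_mul,
    sum_coeff_hat_mul u (fun b => mapDer (v b) f)]
  have hV := hat_der_schur hS0 hS1 hu hSN hN m
  set κ := N (m + 2) + u * N (m + 1)
  set Q : K⟦X⟧ := C (N m) + X * C κ with hQ
  have hVf : hat u (fun b => mapDer (v b) f) 0
      = (n : K⟦X⟧) * Q ^ (n - 1) * (C κ + C (N m) * J 1) := by
    rw [← hV, mul_hat]
    congr 1
    funext b
    rw [hf, Derivation.leibniz_pow, nsmul_eq_mul, smul_eq_mul, mul_assoc]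
  have hf' : d⁄dX K f = (n : K⟦X⟧) * Q ^ (n - 1) * C κ := by
    rw [hf, Derivation.leibniz_pow, nsmul_eq_mul, smul_eq_mul, mul_assoc, hQ, map_add _ (C (N m)),
      Derivation.leibniz, derivative_C, derivative_C, derivative_X]
    simp
  have hXc : coeff n (X * d⁄dX K (f * (J 1 * G))) = (n : K) * coeff n (f * (J 1 * G)) := by
    cases n with
    | zero => rw [coeff_zero_X_mul, Nat.cast_zero, zero_mul]
    | succ n =>
      rw [coeff_succ_X_mul, coeff_derivative]
      push_cast
      ring
  have hQf : (n : K⟦X⟧) * Q ^ (n - 1) * Q = (n : K⟦X⟧) * f := by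
    rcases n with _ | n
    · simp
    · rw [hf, Nat.add_sub_cancel, mul_assoc, ← pow_succ]
  have main : f * (d⁄dX K G - X * d⁄dX K (J 1 * G)) + hat u (fun b => mapDer (v b) f) 0 * G
      = d⁄dX K (f * G) - X * d⁄dX K (f * (J 1 * G)) + C (n : K) * (f * (J 1 * G)) := by
    have hn : (C (n : K) : K⟦X⟧) = (n : K⟦X⟧) := by simp
    rw [hVf, Derivation.leibniz _ f G, Derivation.leibniz _ f (J 1 * G), hf', hn]
    simp only [smul_eq_mul]
    rw [hQ] at hQf ⊢
    linear_combination (J 1 * G) * hQf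
  rw [← map_add, main, map_add, map_sub, hXc, coeff_C_mul, coeff_derivative]
  ring

end Action

/-! ### The weight grading on `ℂ[[x, y]]`. -/

section Weight

/-- The weight of a monomial, where `x_n` and `y_n` have weight `n`. -/
def weight : (ℕ+ ⊕ ℕ+ →₀ ℕ) →+ ℕ :=
  Finsupp.weight (Sum.elim (fun n : ℕ+ => (n : ℕ)) fun n : ℕ+ => (n : ℕ))

/-- All monomials of `f` have weight at least `m`. -/
def WeightGE (m : ℕ) (f : XY) : Prop := ∀ d, weight d < m → MvPowerSeries.coeff d f = 0

namespace WeightGE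

theorem of_zero (f : XY) : WeightGE 0 f := fun _ hd => absurd hd (Nat.not_lt_zero _)

theorem mono {m n : ℕ} {f : XY} (hf : WeightGE n f) (h : m ≤ n) : WeightGE m f :=
  fun d hd => hf d (hd.trans_le h)

theorem zero (m : ℕ) : WeightGE m 0 := fun d _ => by simp

theorem add {m : ℕ} {f g : XY} (hf : WeightGE m f) (hg : WeightGE m g) : WeightGE m (f + g) :=
  fun d hd => by rw [map_add, hf d hd, hg d hd, add_zero]

theorem smul {m : ℕ} {f : XY} (c : ℂ) (hf : WeightGE m f) : WeightGE m (c • f) :=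
  fun d hd => by
    have : MvPowerSeries.coeff d (c • f) = c • MvPowerSeries.coeff d f := rfl
    rw [this, hf d hd, smul_zero]

theorem neg {m : ℕ} {f : XY} (hf : WeightGE m f) : WeightGE m (-f) :=
  fun d hd => by rw [map_neg, hf d hd, neg_zero]

theorem sum {ι : Type*} {m : ℕ} {s : Finset ι} {f : ι → XY} (hf : ∀ i ∈ s, WeightGE m (f i)) :
    WeightGE m (∑ i ∈ s, f i) :=
  fun d hd => by
    rw [map_sum]
    exact Finset.sum_eq_zero fun i hi => hf i hi d hd

theorem mul {m n : ℕ} {f g : XY} (hf : WeightGE m f) (hg : WeightGE n g) :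
    WeightGE (m + n) (f * g) := by
  intro d hd
  rw [MvPowerSeries.coeff_mul]
  refine Finset.sum_eq_zero fun p hp => ?_
  have h : weight p.1 + weight p.2 = weight d := by
    rw [← map_add, Finset.HasAntidiagonal.mem_antidiagonal.1 hp]
  rcases lt_or_ge (weight p.1) m with h1 | h1
  · rw [hf _ h1, zero_mul]
  · rw [hg _ (by omega), mul_zero]

theorem mul_right {m : ℕ} {f : XY} (hf : WeightGE m f) (g : XY) : WeightGE m (f * g) :=
  hf.mul (of_zero g)

theorem mul_left {m : ℕ} {f : XY} (hf : WeightGE m f) (g : XY) : WeightGE m (g * f) := by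
  rw [mul_comm]
  exact hf.mul_right g

theorem pow {m : ℕ} {f : XY} (hf : WeightGE m f) (k : ℕ) : WeightGE (k * m) (f ^ k) := by
  induction k with
  | zero => rw [zero_mul]; exact of_zero _
  | succ k ih => rw [pow_succ, Nat.succ_mul]; exact ih.mul hf

theorem of_X (i : ℕ+ ⊕ ℕ+) :
    WeightGE (Sum.elim (fun n : ℕ+ => (n : ℕ)) (fun n : ℕ+ => (n : ℕ)) i) (MvPowerSeries.X i) := by
  intro d hd
  rw [MvPowerSeries.coeff_X, if_neg]
  rintro rfl
  rw [weight, Finsupp.weight_single] at hd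
  simp at hd

theorem of_x (n : ℕ+) : WeightGE n (x n) := of_X (Sum.inl n)

theorem of_y (n : ℕ+) : WeightGE n (y n) := of_X (Sum.inr n)

theorem constantCoeff_eq_zero {m : ℕ} (hm : 0 < m) {f : XY} (hf : WeightGE m f) :
    MvPowerSeries.constantCoeff f = 0 := by
  rw [← MvPowerSeries.coeff_zero_eq_constantCoeff_apply]
  exact hf 0 (by simpa using hm)

theorem schurS {t : ℕ+ → XY} (ht : ∀ n : ℕ+, WeightGE n (t n)) (k : ℕ) :
    WeightGE k (schurS t (k : ℤ)) := by
  induction k using Nat.strong_induction_on with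
  | _ k ih =>
    cases k with
    | zero => exact of_zero _
    | succ k =>
      have hk : ((k + 1 : ℕ) : ℂ) ≠ 0 := Nat.cast_ne_zero.2 k.succ_ne_zero
      have h2 : FreeBoson.schurS t ((k + 1 : ℕ) : ℤ) = ((k + 1 : ℕ) : ℂ)⁻¹ •
          (((k + 1 : ℕ) : ℂ) • FreeBoson.schurS t ((k + 1 : ℕ) : ℤ)) := by
        rw [smul_smul, inv_mul_cancel₀ hk, one_smul]
      rw [h2, natCast_smul_schurS_succ (fun m n => mul_comm (t m) (t n)) k]
      refine smul _ (sum fun p hp => ?_)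
      have hp' := Finset.HasAntidiagonal.mem_antidiagonal.1 hp
      refine mono (((ht _).smul _).mul (ih p.2 (by omega))) ?_
      rw [Nat.succPNat_coe]
      omega

end WeightGE

end Weight

/-! ### Formal sums controlled by weight. -/

section FormalSum

theorem coeff_formalSum {ι : Type*} (f : ι → XY) (d : ℕ+ ⊕ ℕ+ →₀ ℕ) :
    MvPowerSeries.coeff d (formalSum f) = ∑ᶠ i, MvPowerSeries.coeff d (f i) := rfl

theorem formallySummable_of_weightGE {f : ℕ → XY} (hf : ∀ i, WeightGE i (f i)) :
    FormallySummable f := by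
  intro d
  refine (Finset.finite_toSet (Finset.range (weight d + 1))).subset fun i hi => ?_
  by_contra h
  exact hi (hf i d (by simpa using h))

theorem coeff_formalSum_eq_sum {f : ℕ → XY} (hf : ∀ i, WeightGE i (f i)) {d : ℕ+ ⊕ ℕ+ →₀ ℕ}
    {M : ℕ} (hM : weight d < M) :
    MvPowerSeries.coeff d (formalSum f) = ∑ i ∈ Finset.range M, MvPowerSeries.coeff d (f i) := by
  rw [coeff_formalSum]
  refine finsum_eq_sum_of_support_subset _ fun i hi => ?_
  by_contra h
  have h' : M ≤ i := by simpa using h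
  exact hi (hf i d (by omega))

theorem WeightGE.formalSum {f : ℕ → XY} (hf : ∀ i, WeightGE i (f i)) {m : ℕ}
    (h : ∀ i, WeightGE m (f i)) : WeightGE m (formalSum f) := by
  intro d hd
  rw [coeff_formalSum_eq_sum hf (Nat.lt_succ_self _)]
  exact Finset.sum_eq_zero fun i _ => h i d hd

theorem formalSum_eq_sum {f : ℕ → XY} {B : ℕ} (hf : ∀ i, B ≤ i → f i = 0) :
    formalSum f = ∑ i ∈ Finset.range B, f i := by
  ext d
  rw [coeff_formalSum, map_sum]
  refine finsum_eq_sum_of_support_subset _ fun i hi => ?_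
  by_contra h
  have h' : B ≤ i := by simpa using h
  exact hi (by simp [hf i h'])

theorem formalSum_eq_single {f : ℕ → XY} (n : ℕ) (hf : ∀ i, i ≠ n → f i = 0) :
    formalSum f = f n := by
  ext d
  rw [coeff_formalSum]
  exact finsum_eq_single _ n fun i hi => by rw [hf i hi, map_zero]

@[simp] theorem formalSum_zero {ι : Type*} : formalSum (fun _ : ι => (0 : XY)) = 0 := by
  ext d
  simp [coeff_formalSum]

theorem formalSum_smul {ι : Type*} (c : ℂ) (f : ι → XY) :
    formalSum (fun i => c • f i) = c • formalSum f := by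
  ext d
  have h (g : XY) : MvPowerSeries.coeff d (c • g) = c • MvPowerSeries.coeff d g := rfl
  rw [coeff_formalSum, h, coeff_formalSum, smul_finsum]
  rfl

theorem formalSum_add {f g : ℕ → XY} (hf : ∀ i, WeightGE i (f i)) (hg : ∀ i, WeightGE i (g i)) :
    formalSum (fun i => f i + g i) = formalSum f + formalSum g := by
  ext d
  have hd := Nat.lt_succ_self (weight d)
  rw [map_add, coeff_formalSum_eq_sum hf hd, coeff_formalSum_eq_sum hg hd,
    coeff_formalSum_eq_sum (fun i => (hf i).add (hg i)) hd, ← Finset.sum_add_distrib]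
  simp

theorem mul_formalSum {f : ℕ → XY} (hf : ∀ i, WeightGE i (f i)) (F : XY) :
    F * formalSum f = formalSum fun i => F * f i := by
  ext d
  rw [coeff_formalSum_eq_sum (fun i => (hf i).mul_left F) (Nat.lt_succ_self (weight d)),
    MvPowerSeries.coeff_mul]
  simp only [MvPowerSeries.coeff_mul]
  rw [Finset.sum_comm]
  refine Finset.sum_congr rfl fun p hp => ?_
  have h : weight p.1 + weight p.2 = weight d := by
    rw [← map_add, Finset.HasAntidiagonal.mem_antidiagonal.1 hp]
  rw [coeff_formalSum_eq_sum hf (M := (weight d).succ) (by omega), Finset.mul_sum]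

theorem formalSum_eq_sum_add {f : ℕ → XY} (hf : ∀ i, WeightGE i (f i)) (n : ℕ) :
    formalSum f = ∑ i ∈ Finset.range n, f i + formalSum fun i => f (n + i) := by
  ext d
  rw [map_add, coeff_formalSum_eq_sum hf (M := n + (weight d + 1)) (by omega),
    coeff_formalSum_eq_sum (fun i => (hf _).mono (Nat.le_add_left i n)) (Nat.lt_succ_self _),
    Finset.sum_range_add, map_sum]

theorem formalSum_prod_eq_sum {f : ℕ × ℕ → XY} (hf : ∀ a b, WeightGE a (f (a, b))) {B : ℕ}
    (hB : ∀ a b, B ≤ b → f (a, b) = 0) :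
    formalSum f = ∑ b ∈ Finset.range B, formalSum fun a => f (a, b) := by
  ext d
  rw [coeff_formalSum, map_sum]
  have hsub : (Function.support fun i => MvPowerSeries.coeff d (f i)) ⊆
      ↑(Finset.range (weight d + 1) ×ˢ Finset.range B) := by
    rintro ⟨a, b⟩ hab
    by_contra h
    simp only [Finset.coe_product, Set.mem_prod, Finset.mem_coe, Finset.mem_range, not_and_or,
      not_lt] at h
    rcases h with h | h
    · exact hab (hf a b d (by omega))
    · exact hab (by simp [hB a b h])
  rw [finsum_eq_sum_of_support_subset _ hsub, Finset.sum_product_right]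
  refine Finset.sum_congr rfl fun b _ => ?_
  rw [coeff_formalSum_eq_sum (fun a => hf a b) (Nat.lt_succ_self _)]

end FormalSum

/-! ### The translation operators generated by `∂x_n - ∂y_n`. -/

section Shift

/-- The derivation `∂/∂x_n - ∂/∂y_n`. -/
def delta (n : ℕ+) : Derivation ℂ XY XY :=
  MvPowerSeries.pderiv ℂ (Sum.inl n) - MvPowerSeries.pderiv ℂ (Sum.inr n)

/-- The operators `(∂/∂x_n - ∂/∂y_n) / n`. -/
def shiftArg (n : ℕ+) : Module.End ℂ XY := ((n : ℕ) : ℂ)⁻¹ • (dx n - dy n)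

theorem shiftArg_apply (n : ℕ+) (F : XY) : shiftArg n F = ((n : ℕ) : ℂ)⁻¹ • delta n F := rfl

theorem pderiv_comm (i j : ℕ+ ⊕ ℕ+) (F : XY) :
    MvPowerSeries.pderiv ℂ i (MvPowerSeries.pderiv ℂ j F) =
      MvPowerSeries.pderiv ℂ j (MvPowerSeries.pderiv ℂ i F) := by
  rcases eq_or_ne i j with rfl | h
  · rfl
  ext d
  simp only [MvPowerSeries.coeff_pderiv, Finsupp.add_apply, Finsupp.single_eq_of_ne h,
    Finsupp.single_eq_of_ne h.symm, add_right_comm d (Finsupp.single i 1), add_zero]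
  ring

theorem delta_comm (m n : ℕ+) (F : XY) : delta m (delta n F) = delta n (delta m F) := by
  simp only [delta, Derivation.sub_apply, map_sub, pderiv_comm (Sum.inl m), pderiv_comm (Sum.inr m)]
  ring

theorem shiftArg_comm (m n : ℕ+) : shiftArg m * shiftArg n = shiftArg n * shiftArg m := by
  ext1 F
  simp only [Module.End.mul_apply, shiftArg_apply, Derivation.map_smul, delta_comm m n]
  rw [smul_comm]

theorem neg_shiftArg_comm (m n : ℕ+) : -shiftArg m * -shiftArg n = -shiftArg n * -shiftArg m := by
  ext1 F
  simp only [Module.End.mul_apply, LinearMap.neg_apply, map_neg, neg_neg]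
  exact congrArg (fun T => T F) (shiftArg_comm m n)

theorem schurS_apply_mul {t : ℕ+ → Module.End ℂ XY} (ht : ∀ m n, t m * t n = t n * t m) {f : XY}
    (hf : ∀ n F, t n (f * F) = f * t n F) (b : ℕ) (F : XY) :
    schurS t (b : ℤ) (f * F) = f * schurS t (b : ℤ) F := by
  induction b using Nat.strong_induction_on with
  | _ b ih =>
    cases b with
    | zero => simp
    | succ b =>
      have hk : ((b + 1 : ℕ) : ℂ) ≠ 0 := Nat.cast_ne_zero.2 b.succ_ne_zero
      have h := natCast_smul_schurS_succ ht b
      have key : ((b + 1 : ℕ) : ℂ) • schurS t ((b + 1 : ℕ) : ℤ) (f * F)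
          = ((b + 1 : ℕ) : ℂ) • (f * schurS t ((b + 1 : ℕ) : ℤ) F) := by
        rw [← mul_smul_comm, ← LinearMap.smul_apply, ← LinearMap.smul_apply, h,
          LinearMap.sum_apply, LinearMap.sum_apply, Finset.mul_sum]
        refine Finset.sum_congr rfl fun p hp => ?_
        have hp' := Finset.HasAntidiagonal.mem_antidiagonal.1 hp
        rw [Module.End.mul_apply, Module.End.mul_apply, ih p.2 (by omega), LinearMap.smul_apply,
          LinearMap.smul_apply, hf, mul_smul_comm]
      exact smul_right_injective XY hk key

theorem schurS_succ_apply_eq_zero {t : ℕ+ → Module.End ℂ XY} (ht : ∀ m n, t m * t n = t n * t m)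
    {f : XY} (hf : ∀ n, t n f = 0) (b : ℕ) : schurS t ((b + 1 : ℕ) : ℤ) f = 0 := by
  induction b using Nat.strong_induction_on with
  | _ b ih =>
    have hk : ((b + 1 : ℕ) : ℂ) ≠ 0 := Nat.cast_ne_zero.2 b.succ_ne_zero
    have h := congrArg (fun T => T f) (natCast_smul_schurS_succ ht b)
    simp only [LinearMap.smul_apply, LinearMap.sum_apply, Module.End.mul_apply] at h
    rw [Finset.sum_eq_zero] at h
    · exact (smul_eq_zero.1 h).resolve_left hk
    · intro p hp
      have hp' := Finset.HasAntidiagonal.mem_antidiagonal.1 hp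
      rcases Nat.eq_zero_or_pos p.2 with h0 | h0
      · rw [h0]
        simp [hf]
      · obtain ⟨q, hq⟩ : ∃ q, p.2 = q + 1 := ⟨p.2 - 1, by omega⟩
        rw [hq, ih q (by omega), map_zero, smul_zero]

/-- The components `S_b((∂_x - ∂_y) / n)` of the shift are determined by the equation
`q ∂_q E = (∑_n q ^ n (∂_{x_n} - ∂_{y_n})) E`. -/
theorem schurS_shiftArg_apply_eq {w : ℕ → XY}
    (hw : ∀ b, ((b + 1 : ℕ) : ℂ) • w (b + 1) =
      ∑ p ∈ Finset.HasAntidiagonal.antidiagonal b, delta p.1.succPNat (w p.2)) (b : ℕ) :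
    schurS shiftArg (b : ℤ) (w 0) = w b := by
  induction b using Nat.strong_induction_on with
  | _ b ih =>
    cases b with
    | zero => simp
    | succ b =>
      have hk : ((b + 1 : ℕ) : ℂ) ≠ 0 := Nat.cast_ne_zero.2 b.succ_ne_zero
      refine smul_right_injective XY hk ?_
      simp only
      rw [hw, ← LinearMap.smul_apply, natCast_smul_schurS_succ shiftArg_comm, LinearMap.sum_apply]
      refine Finset.sum_congr rfl fun p hp => ?_
      have hp' := Finset.HasAntidiagonal.mem_antidiagonal.1 hp
      rw [Module.End.mul_apply, ih p.2 (by omega), LinearMap.smul_apply, shiftArg_apply, smul_smul,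
        Nat.succPNat_coe, mul_inv_cancel₀ (Nat.cast_ne_zero.2 p.1.succ_ne_zero), one_smul]

/-- The power series in the variables `x_n + y_n`, characterised as the common kernel of the
derivations `∂/∂x_n - ∂/∂y_n`. -/
def plusSubalgebra : Subalgebra ℂ XY where
  carrier := {f | ∀ n, delta n f = 0}
  mul_mem' {f g} hf hg n := by
    rw [Derivation.leibniz, hf n, hg n, smul_zero, smul_zero, add_zero]
  add_mem' {f g} hf hg n := by rw [map_add, hf n, hg n, add_zero]
  algebraMap_mem' c n := by rw [Derivation.map_algebraMap]

theorem delta_mul_of_mem {f : XY} (hf : f ∈ plusSubalgebra) (n : ℕ+) (F : XY) :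
    delta n (f * F) = f * delta n F := by
  rw [Derivation.leibniz, hf n, smul_zero, add_zero, smul_eq_mul]

theorem shiftArg_mul_of_mem {f : XY} (hf : f ∈ plusSubalgebra) (n : ℕ+) (F : XY) :
    shiftArg n (f * F) = f * shiftArg n F := by
  rw [shiftArg_apply, shiftArg_apply, delta_mul_of_mem hf, mul_smul_comm]

theorem neg_shiftArg_mul_of_mem {f : XY} (hf : f ∈ plusSubalgebra) (n : ℕ+) (F : XY) :
    (-shiftArg n) (f * F) = f * (-shiftArg n) F := by
  rw [LinearMap.neg_apply, LinearMap.neg_apply, shiftArg_mul_of_mem hf, mul_neg]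

@[simp] theorem dx_x (m n : ℕ+) : dx m (x n) = if n = m then 1 else 0 := by
  classical
  have : dx m (x n) = MvPowerSeries.pderiv ℂ (Sum.inl m) (MvPowerSeries.X (Sum.inl n)) := rfl
  rw [this, MvPowerSeries.pderiv_X, Pi.single_apply]
  simp [eq_comm]

@[simp] theorem dy_x (m n : ℕ+) : dy m (x n) = 0 :=
  MvPowerSeries.pderiv_X_of_ne Sum.inl_ne_inr

@[simp] theorem dx_y (m n : ℕ+) : dx m (y n) = 0 :=
  MvPowerSeries.pderiv_X_of_ne Sum.inr_ne_inl

@[simp] theorem dy_y (m n : ℕ+) : dy m (y n) = if n = m then 1 else 0 := by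
  classical
  have : dy m (y n) = MvPowerSeries.pderiv ℂ (Sum.inr m) (MvPowerSeries.X (Sum.inr n)) := rfl
  rw [this, MvPowerSeries.pderiv_X, Pi.single_apply]
  simp [eq_comm]

theorem delta_apply (n : ℕ+) (F : XY) : delta n F = dx n F - dy n F := rfl

theorem add_mem_plusSubalgebra (n : ℕ+) : x n + y n ∈ plusSubalgebra := by
  intro m
  rw [delta_apply]
  simp

theorem schurS_mem {t : ℕ+ → XY} {A : Subalgebra ℂ XY} (ht : ∀ n, t n ∈ A) (k : ℤ) :
    schurS t k ∈ A := by
  have := map_schurS A.val (fun n => (⟨t n, ht n⟩ : A)) k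
  have h2 : schurS t k = A.val (schurS (fun n => (⟨t n, ht n⟩ : A)) k) := by
    rw [this]
    rfl
  rw [h2]
  exact Subtype.property _

end Shift

/-! ### The series `G` and its images under the shift and its inverse. -/

section Setup

/-- The family `n x_n`, extended by `0`. -/
def weightedX (b : ℕ) : XY := if h : 0 < b then (b : ℂ) • x ⟨b, h⟩ else 0

/-- The family of polynomials `g_l` with generating series `exp (∑_n (-1)^(n-1) λ_n s^n / n)`,
where `λ_n = ∑_i C(n, i) (x_1 + y_1)^(n - i) (n + i) x_{n+i}`. -/
def gSeries : XY⟦X⟧ := schurGen (lamArg (x 1 + y 1) weightedX)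

theorem weightedX_coe (k : ℕ+) : weightedX k = ((k : ℕ) : ℂ) • x k := dif_pos k.pos

@[simp] theorem weightedX_zero : weightedX 0 = 0 := rfl

theorem delta_weightedX (n : ℕ+) (b : ℕ) :
    delta n (weightedX b) = (b : XY) * if b = n then 1 else 0 := by
  rcases Nat.eq_zero_or_pos b with rfl | hb
  · simp
  · obtain ⟨k, rfl⟩ : ∃ k : ℕ+, (k : ℕ) = b := ⟨⟨b, hb⟩, rfl⟩
    rw [weightedX_coe, Derivation.map_smul, delta_apply, dx_x, dy_x, sub_zero, Algebra.smul_def]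
    simp [PNat.coe_inj]

/-- The derivations `∂/∂x_n - ∂/∂y_n` multiply `gSeries` by the coefficients of
`q ∂_q log (1 + s (q ^ 2 + u q))`. -/
theorem mapDer_delta_gSeries :
    mapDer (delta 1) gSeries = X * (C (x 1 + y 1) * gSeries) ∧
    mapDer (delta 2) gSeries + X * (C (x 1 + y 1) * mapDer (delta 1) gSeries)
      = 2 * X * gSeries ∧
    ∀ n : ℕ, mapDer (delta (n + 2).succPNat) gSeries + X * (C (x 1 + y 1) *
      mapDer (delta (n + 1).succPNat) gSeries + mapDer (delta n.succPNat) gSeries) = 0 := by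
  set u : XY := x 1 + y 1 with hu
  -- `J n m` is the coefficient of `q^n` in `q^(m+1) / (1 + s w)`.
  set J : ℕ → ℕ → XY⟦X⟧ := fun n => hat u fun m => C (if m + 1 = n then 1 else 0) with hJ
  have hD : ∀ n : ℕ, mapDer (delta n.succPNat) gSeries =
      gSeries * (X * (2 * J (n + 1) 1 + C u * J (n + 1) 0)) := by
    intro n
    have := mapDer_schurGen_lamArg (delta n.succPNat) (u := u) (c := weightedX) (e := 0)
      (d := fun b => if b = n + 1 then 1 else 0) (add_mem_plusSubalgebra 1 _)
      (fun b => delta_weightedX n.succPNat b)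
    rw [gSeries, ← hu, this]
    simp only [map_zero, zero_mul, zero_add, hJ]
  have hshift : ∀ n m, J (n + 1) (m + 1) = J n m := by
    intro n m
    simp only [hJ]
    rw [← hat_shift u (fun m => C (if m + 1 = n + 1 then 1 else 0)) 1]
    simp
  have h0 : ∀ m, J 0 m = 0 := by
    intro m
    refine (eq_hat (F := fun _ => 0) (fun k => ?_) m).symm
    simp
  have hadd : ∀ n, J (n + 1) 0 + X * (J (n + 1) 2 + C u * J n 0)
      = C (if 0 + 1 = n + 1 then 1 else 0) := by
    intro n
    have := hat_add u (fun m => C (if m + 1 = n + 1 then (1 : XY) else 0)) 0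
    rw [← hshift n 0]
    exact this
  have h1 : J 1 0 = 1 := by
    have := hadd 0
    rw [hshift 0 1, h0, h0] at this
    simpa using this
  have hrec : ∀ n, J (n + 2) 0 + X * (J n 0 + C u * J (n + 1) 0) = 0 := by
    intro n
    have := hadd (n + 1)
    rw [hshift (n + 1) 1, hshift n 0] at this
    simpa using this
  have e1 := hD 0
  have e2 := hD 1
  have d1 : delta 1 = delta (Nat.succPNat 0) := rfl
  have d2 : delta 2 = delta (Nat.succPNat 1) := rfl
  refine ⟨?_, ?_, fun n => ?_⟩
  · rw [d1, e1, hshift 0 0, h0, h1]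
    ring
  · rw [d1, d2, e1, e2, hshift 1 0, hshift 0 0, h0, h1]
    have := hrec 0
    rw [h0, h1] at this
    linear_combination (gSeries * X * C u) * this
  · rw [hD, hD, hD, hshift, hshift, hshift]
    linear_combination (2 * gSeries * X) * hrec n + (gSeries * X * C u) * hrec (n + 1)

/-- The shift multiplies `G` by `1 + s (u q + q²)`. By `mapDer_delta_gSeries` these candidate
components satisfy the differential equation in `q` that characterises the shift. -/
theorem schurS_shiftArg_gSeries (l b : ℕ) :
    schurS shiftArg (b : ℤ) (coeff l gSeries) = coeff l
      ((if b = 0 then 1 else if b = 1 then X * C (x 1 + y 1) else if b = 2 then X else 0)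
        * gSeries) := by
  obtain ⟨h1, h2, h3⟩ := mapDer_delta_gSeries
  set u : XY := x 1 + y 1 with hu
  set w : ℕ → XY⟦X⟧ := fun b =>
    if b = 0 then 1 else if b = 1 then X * C u else if b = 2 then X else 0 with hw
  have key := schurS_shiftArg_apply_eq (w := fun b => coeff l (w b * gSeries)) (fun b => ?_) b
  · have hw0 : w 0 * gSeries = gSeries := by simp [hw]
    simp only [hw0] at key
    exact key
  · have hmem : ∀ n : ℕ+, delta n u = 0 := add_mem_plusSubalgebra 1
    have hsum : ∑ p ∈ Finset.HasAntidiagonal.antidiagonal b,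
        delta p.1.succPNat (coeff l (w p.2 * gSeries))
        = coeff l (∑ p ∈ Finset.HasAntidiagonal.antidiagonal b,
          w p.2 * mapDer (delta p.1.succPNat) gSeries) := by
      rw [map_sum]
      refine Finset.sum_congr rfl fun p _ => ?_
      rw [← coeff_mapDer, Derivation.leibniz]
      have : mapDer (delta p.1.succPNat) (w p.2) = 0 := by
        simp only [hw]
        split_ifs
        · exact Derivation.map_one_eq_zero _
        · rw [Derivation.leibniz, mapDer_X, mapDer_C, hmem]
          simp
        · exact mapDer_X _
        · exact map_zero _
      rw [this, smul_zero, add_zero, smul_eq_mul]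
    have hl : ((b + 1 : ℕ) : ℂ) • coeff l (w (b + 1) * gSeries)
        = coeff l (((b + 1 : ℕ) : XY⟦X⟧) * (w (b + 1) * gSeries)) := by
      rw [← nsmul_eq_mul, map_nsmul, Nat.cast_smul_eq_nsmul]
    rw [hsum, hl]
    congr 1
    rcases b with _ | _ | b
    · simp only [Finset.Nat.antidiagonal_zero, Finset.sum_singleton]
      have : mapDer (delta (Nat.succPNat 0)) gSeries = X * (C u * gSeries) := h1
      rw [this]
      simp [hw, mul_assoc]
    · rw [Finset.Nat.sum_antidiagonal_succ']
      simp only [Finset.Nat.antidiagonal_zero, Finset.sum_singleton]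
      have e1 : mapDer (delta (Nat.succPNat (0 + 1))) gSeries
        + X * (C u * mapDer (delta (Nat.succPNat 0)) gSeries) = 2 * X * gSeries := h2
      simp [hw] at e1 ⊢
      linear_combination -e1
    · rw [Finset.Nat.sum_antidiagonal_succ', Finset.Nat.sum_antidiagonal_succ']
      have hz : ∀ p ∈ Finset.HasAntidiagonal.antidiagonal b, w (p.2 + 1 + 1) *
          mapDer (delta p.1.succPNat) gSeries
          = if p.2 = 0 then X * mapDer (delta b.succPNat) gSeries else 0 := by
        intro p hp
        have hp' := Finset.HasAntidiagonal.mem_antidiagonal.1 hp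
        by_cases h : p.2 = 0
        · have : p.1 = b := by omega
          simp [hw, h, this]
        · simp [hw, h]
      simp only at hz ⊢
      rw [Finset.sum_congr rfl hz]
      have hs : (∑ p ∈ Finset.HasAntidiagonal.antidiagonal b,
          if p.2 = 0 then X * mapDer (delta b.succPNat) gSeries else 0)
          = X * mapDer (delta b.succPNat) gSeries := by
        rw [Finset.sum_eq_single (b, 0)]
        · simp
        · intro p hp hne
          rw [if_neg]
          intro h0
          apply hne
          have hp' := Finset.HasAntidiagonal.mem_antidiagonal.1 hp
          ext
          · simp only; omega
          · exact h0
        · intro h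
          exact absurd (Finset.HasAntidiagonal.mem_antidiagonal.2 (by simp)) h
      rw [hs]
      have e := h3 b
      have w0 : w 0 = 1 := by simp [hw]
      have w1 : w (0 + 1) = X * C u := by simp [hw]
      have w3 : w (b + 1 + 1 + 1) = 0 := by simp [hw]
      rw [w0, w1, w3]
      linear_combination -e

/-- The components of the inverse shift applied to `g_l`. -/
def invShift (l b : ℕ) : XY := schurS (fun n => -shiftArg n) (b : ℤ) (coeff l gSeries)

theorem invShift_zero_right (l : ℕ) : invShift l 0 = coeff l gSeries := by
  simp [invShift]

theorem sum_invShift (l b : ℕ) :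
    ∑ p ∈ Finset.HasAntidiagonal.antidiagonal (b + 1),
      schurS (fun n => -shiftArg n) (p.1 : ℤ) (schurS shiftArg (p.2 : ℤ) (coeff l gSeries)) = 0 := by
  have := congrArg (fun T => T (coeff l gSeries)) (sum_schurS_neg_mul_schurS shiftArg_comm (b + 1))
  simpa [LinearMap.sum_apply] using this

theorem coeff_zero_gSeries : coeff 0 gSeries = 1 := by
  simp [gSeries]

theorem invShift_zero_left (b : ℕ) : invShift 0 (b + 1) = 0 := by
  rw [invShift, coeff_zero_gSeries]
  refine schurS_succ_apply_eq_zero neg_shiftArg_comm (fun n => ?_) b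
  rw [LinearMap.neg_apply, shiftArg_apply, Derivation.map_one_eq_zero, smul_zero, neg_zero]

theorem schurS_neg_shiftArg_mul {f : XY} (hf : f ∈ plusSubalgebra) (b : ℕ) (F : XY) :
    schurS (fun n => -shiftArg n) (b : ℤ) (f * F) =
      f * schurS (fun n => -shiftArg n) (b : ℤ) F :=
  schurS_apply_mul neg_shiftArg_comm (neg_shiftArg_mul_of_mem hf) b F

theorem schurS_shiftArg_mul {f : XY} (hf : f ∈ plusSubalgebra) (b : ℕ) (F : XY) :
    schurS shiftArg (b : ℤ) (f * F) = f * schurS shiftArg (b : ℤ) F :=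
  schurS_apply_mul shiftArg_comm (shiftArg_mul_of_mem hf) b F

theorem schurS_shiftArg_one_gSeries (l : ℕ) :
    schurS shiftArg ((0 + 1 : ℕ) : ℤ) (coeff (l + 1) gSeries) = (x 1 + y 1) * coeff l gSeries := by
  rw [schurS_shiftArg_gSeries]
  simp only [Nat.reduceAdd, one_ne_zero, if_false, if_true]
  rw [mul_assoc, coeff_succ_X_mul, coeff_C_mul]

theorem schurS_shiftArg_two_gSeries (l : ℕ) :
    schurS shiftArg ((0 + 1 + 1 : ℕ) : ℤ) (coeff (l + 1) gSeries) = coeff l gSeries := by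
  rw [schurS_shiftArg_gSeries]
  simp only [Nat.reduceAdd, OfNat.ofNat_ne_zero, OfNat.ofNat_ne_one, if_false, if_true]
  rw [coeff_succ_X_mul]

theorem schurS_shiftArg_gSeries_of_lt (l b : ℕ) :
    schurS shiftArg ((b + 3 : ℕ) : ℤ) (coeff l gSeries) = 0 := by
  rw [schurS_shiftArg_gSeries]
  simp

theorem invShift_succ_one (l : ℕ) : invShift (l + 1) 1 = -((x 1 + y 1) * invShift l 0) := by
  have h := sum_invShift (l + 1) 0
  rw [Finset.Nat.sum_antidiagonal_succ'] at h
  simp only [Finset.Nat.antidiagonal_zero, Finset.sum_singleton] at h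
  rw [schurS_shiftArg_one_gSeries] at h
  rw [invShift_zero_right]
  simp only [Nat.cast_zero, schurS_zero, Module.End.one_apply] at h
  exact eq_neg_of_add_eq_zero_left h

/-- Composing the inverse shift with the shift, which has only three nonzero components on `G`,
gives the recurrence for dividing by `1 + s (u q + q²)`. -/
theorem invShift_succ_add_two (l b : ℕ) :
    invShift (l + 1) (b + 2) = -((x 1 + y 1) * invShift l (b + 1)) - invShift l b := by
  have h := sum_invShift (l + 1) (b + 1)
  rw [Finset.Nat.sum_antidiagonal_succ', Finset.Nat.sum_antidiagonal_succ'] at h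
  have hz : ∀ p ∈ Finset.HasAntidiagonal.antidiagonal b,
      schurS (fun n => -shiftArg n) (p.1 : ℤ)
        (schurS shiftArg ((p.2 + 1 + 1 : ℕ) : ℤ) (coeff (l + 1) gSeries))
      = if p.2 = 0 then invShift l b else 0 := by
    intro p hp
    have hp' := Finset.HasAntidiagonal.mem_antidiagonal.1 hp
    by_cases h : p.2 = 0
    · have hb : p.1 = b := by omega
      rw [if_pos h, h, schurS_shiftArg_two_gSeries, hb, invShift]
    · obtain ⟨q, hq⟩ : ∃ q, p.2 = q + 1 := ⟨p.2 - 1, by omega⟩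
      rw [if_neg h, hq, schurS_shiftArg_gSeries_of_lt, map_zero]
  simp only at hz h
  rw [Finset.sum_congr rfl hz, Finset.sum_eq_single (b, 0), schurS_shiftArg_one_gSeries,
    schurS_neg_shiftArg_mul (add_mem_plusSubalgebra 1)] at h
  · simp only [Nat.cast_zero, schurS_zero, Module.End.one_apply, if_true] at h
    simp only [invShift] at h ⊢
    linear_combination h
  · intro p hp hne
    rw [if_neg]
    intro h0
    apply hne
    have hp' := Finset.HasAntidiagonal.mem_antidiagonal.1 hp
    ext
    · simp only; omega
    · exact h0
  · intro h
    exact absurd (Finset.HasAntidiagonal.mem_antidiagonal.2 (by simp)) h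

theorem invShift_eq_zero {l b : ℕ} (h : 2 * l < b) : invShift l b = 0 := by
  induction l generalizing b with
  | zero =>
    obtain ⟨b, rfl⟩ : ∃ b', b = b' + 1 := ⟨b - 1, by omega⟩
    exact invShift_zero_left b
  | succ l ih =>
    obtain ⟨b, rfl⟩ : ∃ b', b = b' + 2 := ⟨b - 2, by omega⟩
    rw [invShift_succ_add_two, ih (by omega), ih (by omega)]
    ring

end Setup

/-! ### Schur polynomials in `x + y` and `-x - y`. -/

section SchurXY

theorem schurS_one {A : Type*} [Ring A] [Algebra ℂ A] (t : ℕ+ → A) : schurS t 1 = t 1 := by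
  have h := schurS_natCast t 1
  rw [Finset.sum_range_succ, Finset.sum_range_one] at h
  have e : coeff 1 (genSeries t) = t 1 := coeff_genSeries_succ t 0
  simpa [coeff_one, e] using h

theorem Splus_one : Splus 1 = x 1 + y 1 := schurS_one _

theorem Sminus_eq (k : ℤ) : Sminus k = schurS (fun n => -(x n + y n)) k := by
  rw [Sminus]
  congr 1
  funext n
  rw [neg_add']

theorem weightGE_add (n : ℕ+) : WeightGE n (x n + y n) := (WeightGE.of_x n).add (WeightGE.of_y n)

theorem weightGE_Splus (k : ℕ) : WeightGE k (Splus (k : ℤ)) := WeightGE.schurS weightGE_add k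

theorem weightGE_Sminus (k : ℕ) : WeightGE k (Sminus (k : ℤ)) := by
  rw [Sminus_eq]
  exact WeightGE.schurS (fun n => (weightGE_add n).neg) k

theorem Sminus_mem (k : ℤ) : Sminus k ∈ plusSubalgebra := by
  rw [Sminus_eq]
  exact schurS_mem (fun n => neg_mem (add_mem_plusSubalgebra n)) k

theorem sum_Splus_mul_Sminus (m : ℕ) :
    ∑ i ∈ Finset.range (m + 2), Splus (i : ℤ) * Sminus ((m + 1 - i : ℕ) : ℤ) = 0 := by
  have h := congrArg (coeff (m + 1)) (schurGen_neg_mul fun n => x n + y n)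
  rw [mul_comm, coeff_mul, coeff_one, if_neg (by omega),
    Finset.Nat.sum_antidiagonal_eq_sum_range_succ_mk] at h
  rw [← h]
  refine Finset.sum_congr rfl fun i _ => ?_
  rw [coeff_schurGen, coeff_schurGen, Sminus_eq, Splus]

end SchurXY

/-! ### The annihilation part of `φ*_{-1}` as a derivation. -/

section VertexDerivation

theorem weightGE_Splus_mul (k i : ℕ) (F : XY) :
    WeightGE i (Splus ((i + k + 3 : ℕ) : ℤ) * F) :=
  ((weightGE_Splus (i + k + 3)).mul_right F).mono (by omega)

/-- The derivation `∑_{n ≥ 1} S_{n+k+2}(x + y) ∂/∂x_n`. -/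
def vertexDer (k : ℕ) : Derivation ℂ XY XY :=
  Derivation.mk'
    { toFun := fun F => formalSum fun i : ℕ => Splus ((i + k + 3 : ℕ) : ℤ) * dx i.succPNat F
      map_add' := fun F H => by
        rw [← formalSum_add (fun i => weightGE_Splus_mul k i _) fun i => weightGE_Splus_mul k i _]
        simp only [map_add, mul_add]
      map_smul' := fun c F => by
        rw [RingHom.id_apply, ← formalSum_smul]
        simp only [map_smul, mul_smul_comm] }
    (fun F H => by
      simp only [LinearMap.coe_mk, AddHom.coe_mk, smul_eq_mul]
      rw [mul_formalSum (fun i => weightGE_Splus_mul k i _),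
        mul_formalSum (fun i => weightGE_Splus_mul k i _),
        ← formalSum_add (fun i => (weightGE_Splus_mul k i _).mul_left _)
          (fun i => (weightGE_Splus_mul k i _).mul_left _)]
      congr 1
      funext i
      have : dx i.succPNat (F * H) = F * dx i.succPNat H + H * dx i.succPNat F :=
        Derivation.leibniz (MvPowerSeries.pderiv ℂ (Sum.inl i.succPNat)) F H
      rw [this]
      ring)

theorem vertexDer_apply (k : ℕ) (F : XY) : vertexDer k F =
    formalSum fun i : ℕ => Splus ((i + k + 3 : ℕ) : ℤ) * dx i.succPNat F := rfl

theorem vertexDer_x (k : ℕ) (n : ℕ+) : vertexDer k (x n) = Splus ((n + k + 2 : ℕ) : ℤ) := by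
  rw [vertexDer_apply, formalSum_eq_single n.natPred]
  · rw [dx_x, if_pos n.succPNat_natPred.symm, mul_one]
    congr 2
    have := n.natPred_add_one
    omega
  · intro i hi
    rw [dx_x, if_neg, mul_zero]
    rintro rfl
    exact hi (Nat.natPred_succPNat i).symm

theorem vertexDer_y (k : ℕ) (n : ℕ+) : vertexDer k (y n) = 0 := by
  rw [vertexDer_apply]
  simp

theorem vertexDer_add (k : ℕ) (n : ℕ+) :
    vertexDer k (x n + y n) = Splus ((n + k + 2 : ℕ) : ℤ) := by
  rw [map_add, vertexDer_x, vertexDer_y, add_zero]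

theorem vertexDer_weightedX (k b : ℕ) :
    vertexDer k (weightedX b) = (b : XY) * Splus ((b + k + 2 : ℕ) : ℤ) := by
  rcases Nat.eq_zero_or_pos b with rfl | hb
  · simp
  · obtain ⟨n, rfl⟩ : ∃ k : ℕ+, (k : ℕ) = b := ⟨⟨b, hb⟩, rfl⟩
    rw [weightedX_coe, Derivation.map_smul, vertexDer_x, Algebra.smul_def]
    simp

/-- Logarithmic differentiation gives the convolution with `i ≥ 1` only; the product in front
restores the term `i = 0`, so that the sum has a uniform range. -/
theorem vertexDer_Sminus (k m : ℕ) : vertexDer k (Sminus (m : ℤ)) =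
    Sminus (m : ℤ) * Splus ((k + 2 : ℕ) : ℤ) -
      ∑ i ∈ Finset.range (m + 1), Splus ((i + k + 2 : ℕ) : ℤ) * Sminus ((m - i : ℕ) : ℤ) := by
  have h := congrArg (coeff m) (mapDer_schurGen (vertexDer k) fun n => -(x n + y n))
  rw [coeff_mapDer, coeff_schurGen, ← Sminus_eq, mul_comm, coeff_mul,
    Finset.Nat.sum_antidiagonal_eq_sum_range_succ_mk] at h
  rw [h, Finset.sum_range_succ', Finset.sum_range_succ']
  have e0 : vertexDer k (coeff 0 (genSeries fun n => -(x n + y n))) = 0 := by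
    simp
  have e1 : ∀ i, vertexDer k (coeff (i + 1) (genSeries fun n => -(x n + y n)))
      = - Splus ((i + 1 + k + 2 : ℕ) : ℤ) := by
    intro i
    rw [coeff_genSeries_succ, map_neg, vertexDer_add, Nat.succPNat_coe]
  simp only [coeff_mapDer, coeff_schurGen, e0, e1, ← Sminus_eq, zero_add, Nat.sub_zero]
  simp only [neg_mul, Finset.sum_neg_distrib]
  ring

end VertexDerivation

/-! ### The modes `φ_{-j}` and `φ*_{-1}` on a single charge. -/

section Modes

@[simp] theorem alpha_zero (c k : ℤ) : alpha c k 0 = 0 := by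
  unfold alpha
  split_ifs <;> simp

theorem alpha_smul (c k : ℤ) (a : ℂ) (F : XY) : alpha c k (a • F) = a • alpha c k F := by
  unfold alpha
  split_ifs
  · rw [map_smul]
  · rw [mul_smul_comm, smul_comm]
  · rw [smul_comm]

theorem alpha_succ (c : ℤ) {k : ℤ} {i : ℕ} (h : k = i + 1) (F : XY) :
    alpha c k F = dx i.succPNat F := by
  subst h
  unfold alpha
  rw [dif_pos (by omega)]
  congr 2

theorem alpha_neg_of_pos (c : ℤ) {k : ℤ} {n : ℕ} (hn : 0 < n) (h : k = -n) (F : XY) :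
    alpha c k F = weightedX n * F := by
  subst h
  unfold alpha weightedX
  rw [dif_neg (by omega), dif_pos (by omega), dif_pos hn, smul_mul_assoc]
  have e : (⟨(- -(n : ℤ)).toNat, by omega⟩ : ℕ+) = ⟨n, hn⟩ :=
    PNat.eq (by change (- -(n : ℤ)).toNat = n; omega)
  refine congrArg₂ _ (by simp) (congrArg (fun z => x z * F) e)

theorem alpha_zero_zero (F : XY) : alpha 0 0 F = 0 := by
  simp [alpha]

theorem formalSum_alpha (b : ℕ) (F : XY) :
    (formalSum fun a : ℕ => Splus (a : ℤ) * alpha 0 ((a : ℤ) - b - 1 + -1) F) =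
      (∑ a ∈ Finset.range (b + 2), Splus (a : ℤ) * weightedX (b + 2 - a)) * F + vertexDer b F := by
  -- The mode index is `a - b - 2`: creation operators for `a < b + 2`, then `α_0`, which vanishes
  -- in charge zero, then annihilation operators from `a = b + 3` on.
  rw [formalSum_eq_sum_add (fun i => (weightGE_Splus i).mul_right _) (b + 3), Finset.sum_range_succ,
    alpha_zero_zero' b F, mul_zero, add_zero, Finset.sum_mul, vertexDer_apply]
  congr 1
  · refine Finset.sum_congr rfl fun a ha => ?_
    have ha' := Finset.mem_range.1 ha
    rw [alpha_neg_of_pos 0 (n := b + 2 - a) (by omega) (by omega), mul_assoc]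
  · congr 1
    funext i
    rw [alpha_succ 0 (i := i) (by omega), show b + 3 + i = i + b + 3 by ring]
where
  alpha_zero_zero' (b : ℕ) (F : XY) : alpha 0 (((b + 2 : ℕ) : ℤ) - b - 1 + -1) F = 0 := by
    rw [show ((b + 2 : ℕ) : ℤ) - b - 1 + -1 = 0 by omega, alpha_zero_zero]

theorem phiStar_ofXY {F : XY} {B : ℕ}
    (hB : ∀ b : ℕ, B ≤ b → schurS (fun n => -shiftArg n) (b : ℤ) F = 0) :
    phiStar (-1) (ofXY F) = Pi.single 1 (∑ b ∈ Finset.range B,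
      ((∑ a ∈ Finset.range (b + 2), Splus (a : ℤ) * weightedX (b + 2 - a)) *
        schurS (fun n => -shiftArg n) (b : ℤ) F
        + vertexDer b (schurS (fun n => -shiftArg n) (b : ℤ) F))) := by
  funext m
  change (formalSum fun ab : ℕ × ℕ => Splus ab.1 * alpha (m - 1) ((ab.1 : ℤ) - ab.2 - 1 + -1)
    (schurS (fun n => -shiftArg n) ab.2 ((Pi.single 0 F : Fock) (m - 1)))) = _
  rcases eq_or_ne m 1 with rfl | hm
  · rw [Pi.single_eq_same, sub_self, Pi.single_eq_same]
    have h := formalSum_prod_eq_sum (f := fun ab : ℕ × ℕ => Splus ab.1 *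
        alpha 0 ((ab.1 : ℤ) - ab.2 - 1 + -1) (schurS (fun n => -shiftArg n) ab.2 F))
      (fun a b => (weightGE_Splus a).mul_right _) (B := B)
      (fun a b hb => by simp only [hB b hb, alpha_zero, mul_zero])
    rw [h]
    refine Finset.sum_congr rfl fun b _ => ?_
    simp only
    rw [formalSum_alpha]
  · rw [Pi.single_eq_of_ne hm, Pi.single_eq_of_ne (sub_ne_zero.2 hm)]
    simp

theorem phi_single {F : XY} {B : ℕ} (m : ℕ)
    (hB : ∀ b : ℕ, B ≤ b → schurS shiftArg (b : ℤ) F = 0) :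
    phi (-((m + 1 : ℕ) : ℤ)) (Pi.single 1 F) = ofXY (∑ b ∈ Finset.range B,
      Sminus ((b + m : ℕ) : ℤ) * schurS shiftArg (b : ℤ) F) := by
  funext k
  change (formalSum fun b : ℕ => schurS (fun n => -(x n + y n)) ((b : ℤ) - -((m + 1 : ℕ) : ℤ) - 1) *
    schurS shiftArg b ((Pi.single 1 F : Fock) (k + 1))) = _
  rcases eq_or_ne k 0 with rfl | hk
  · rw [ofXY, Pi.single_eq_same, zero_add, Pi.single_eq_same,
      formalSum_eq_sum (B := B) (fun b hb => by simp only [hB b hb, mul_zero])]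
    refine Finset.sum_congr rfl fun b _ => ?_
    rw [← Sminus_eq, show (b : ℤ) - -((m + 1 : ℕ) : ℤ) - 1 = ((b + m : ℕ) : ℤ) by push_cast; ring]
  · rw [ofXY, Pi.single_eq_of_ne hk, Pi.single_eq_of_ne (fun h => hk (by omega))]
    simp

theorem phi_smul (i : ℤ) (c : ℂ) (f : Fock) : phi i (c • f) = c • phi i f := by
  funext m
  rw [Pi.smul_apply]
  unfold phi
  rw [← formalSum_smul]
  simp only [Pi.smul_apply, map_smul, mul_smul_comm]

theorem phiStar_smul (i : ℤ) (c : ℂ) (f : Fock) : phiStar i (c • f) = c • phiStar i f := by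
  funext m
  rw [Pi.smul_apply]
  unfold phiStar
  rw [← formalSum_smul]
  simp only [Pi.smul_apply, map_smul, alpha_smul, mul_smul_comm]

end Modes

/-! ### Iterating `φ_{-j} φ*_{-1}` on the vacuum. -/

section Iterate

/-- The polynomial `S_{j-1}(-x-y) + s (S_{j+1}(-x-y) + (x_1 + y_1) S_j(-x-y))` for `j = m + 1`. -/
def symbol (m : ℕ) : XY⟦X⟧ :=
  C (Sminus (m : ℤ)) + X * C (Sminus ((m + 2 : ℕ) : ℤ) + (x 1 + y 1) * Sminus ((m + 1 : ℕ) : ℤ))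

theorem coeff_mem_of_mem {A : Subalgebra ℂ XY} {f g : XY⟦X⟧} (hf : ∀ i, coeff i f ∈ A)
    (hg : ∀ i, coeff i g ∈ A) (i : ℕ) : coeff i (f * g) ∈ A := by
  rw [coeff_mul]
  exact sum_mem fun p _ => mul_mem (hf _) (hg _)

theorem coeff_C_mem {A : Subalgebra ℂ XY} {a : XY} (ha : a ∈ A) (i : ℕ) : coeff i (C a) ∈ A := by
  rw [coeff_C]
  split_ifs
  exacts [ha, zero_mem A]

theorem coeff_symbol_mem (m i : ℕ) : coeff i (symbol m) ∈ plusSubalgebra := by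
  rw [symbol, map_add]
  refine add_mem (coeff_C_mem (Sminus_mem _) i) (coeff_mem_of_mem (fun i => ?_) (coeff_C_mem ?_) i)
  · rw [coeff_X]
    split_ifs
    exacts [one_mem _, zero_mem _]
  · exact add_mem (Sminus_mem _) (mul_mem (add_mem_plusSubalgebra 1) (Sminus_mem _))

theorem coeff_symbol_pow_mem (m n i : ℕ) : coeff i (symbol m ^ n) ∈ plusSubalgebra := by
  induction n generalizing i with
  | zero =>
    rw [pow_zero, coeff_one]
    split_ifs
    exacts [one_mem _, zero_mem _]
  | succ n ih =>
    rw [pow_succ]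
    exact coeff_mem_of_mem ih (coeff_symbol_mem m) i

/-- The coefficient of `s ^ n` in `symbol m ^ n * gSeries`. -/
def iterTerm (m n : ℕ) : XY := coeff n (symbol m ^ n * gSeries)

theorem schurS_neg_shiftArg_coeff_mul {f : XY⟦X⟧} (hf : ∀ i, coeff i f ∈ plusSubalgebra) (n b : ℕ) :
    schurS (fun k => -shiftArg k) (b : ℤ) (coeff n (f * gSeries)) =
      ∑ p ∈ Finset.HasAntidiagonal.antidiagonal n, coeff p.1 f * invShift p.2 b := by
  rw [coeff_mul, map_sum]
  exact Finset.sum_congr rfl fun p _ => schurS_neg_shiftArg_mul (hf p.1) b _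

theorem schurS_shiftArg_coeff_mul {f : XY⟦X⟧} (hf : ∀ i, coeff i f ∈ plusSubalgebra) (n b : ℕ) :
    schurS shiftArg (b : ℤ) (coeff n (f * gSeries)) = coeff n (f *
      ((if b = 0 then 1 else if b = 1 then X * C (x 1 + y 1) else if b = 2 then X else 0)
        * gSeries)) := by
  rw [coeff_mul, map_sum, coeff_mul]
  refine Finset.sum_congr rfl fun p _ => ?_
  rw [schurS_shiftArg_mul (hf p.1), schurS_shiftArg_gSeries]

theorem phiStar_iterTerm (m n : ℕ) : phiStar (-1) (ofXY (iterTerm m n)) =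
    Pi.single 1 (((n : XY) + 1) * coeff (n + 1) (symbol m ^ n * gSeries)) := by
  have hmem := coeff_symbol_pow_mem m n
  rw [iterTerm, phiStar_ofXY (B := 2 * n + 1) (fun b hb => ?_)]
  · congr 1
    simp only [schurS_neg_shiftArg_coeff_mul hmem]
    exact sum_alpha_coeff_mul (S := fun k => Splus (k : ℤ)) (N := fun k => Sminus (k : ℤ))
      (schurS_zero _) Splus_one (fun b => by
        rw [vertexDer_add, PNat.one_coe, show 1 + b + 2 = b + 3 by ring])
      (fun b k => vertexDer_weightedX b k) sum_Splus_mul_Sminus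
      (fun b k => vertexDer_Sminus b k) invShift_zero_right invShift_zero_left
      invShift_succ_one invShift_succ_add_two m n (2 * n + 1) le_rfl _ rfl
  · rw [schurS_neg_shiftArg_coeff_mul hmem]
    refine Finset.sum_eq_zero fun p hp => ?_
    have := Finset.HasAntidiagonal.mem_antidiagonal.1 hp
    rw [invShift_eq_zero (by omega), mul_zero]

/-- The shift passes through `f` and multiplies `G` by `1 + s u q + s q²`. The first exponential in
`φ` weights these three terms by `N_m`, `N_{m+1}`, `N_{m+2}`, and the result is `symbol m`. -/
theorem phi_single_coeff_mul {f : XY⟦X⟧} (hf : ∀ i, coeff i f ∈ plusSubalgebra) (m n : ℕ) :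
    phi (-((m + 1 : ℕ) : ℤ)) (Pi.single 1 (coeff n (f * gSeries))) =
      ofXY (coeff n (f * symbol m * gSeries)) := by
  rw [phi_single (B := 3) m (fun b hb => ?_)]
  · congr 1
    simp only [schurS_shiftArg_coeff_mul hf]
    rw [Finset.sum_range_succ, Finset.sum_range_succ, Finset.sum_range_one]
    simp only [← coeff_C_mul]
    rw [← map_add, ← map_add]
    congr 1
    simp only [symbol, one_ne_zero, OfNat.ofNat_ne_zero, OfNat.ofNat_ne_one, if_true, if_false,
      map_add, map_mul]
    rw [zero_add, add_comm 2 m, add_comm 1 m]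
    ring
  · rw [schurS_shiftArg_coeff_mul hf, if_neg (by omega), if_neg (by omega), if_neg (by omega),
      zero_mul, mul_zero, map_zero]

theorem phi_phiStar_iterTerm (m n : ℕ) :
    phi (-((m + 1 : ℕ) : ℤ)) (phiStar (-1) (ofXY (iterTerm m n))) =
      ((n + 1 : ℕ) : ℂ) • ofXY (iterTerm m (n + 1)) := by
  have h : (Pi.single 1 (((n : XY) + 1) * coeff (n + 1) (symbol m ^ n * gSeries)) : Fock)
      = ((n + 1 : ℕ) : ℂ) • Pi.single 1 (coeff (n + 1) (symbol m ^ n * gSeries)) := by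
    rw [← Pi.single_smul, Algebra.smul_def]
    simp
  rw [phiStar_iterTerm, h, phi_smul, phi_single_coeff_mul (coeff_symbol_pow_mem m n), ← pow_succ,
    iterTerm]

theorem iterTerm_zero (m : ℕ) : iterTerm m 0 = 1 := by
  rw [iterTerm, pow_zero, one_mul, coeff_zero_gSeries]

theorem iterate_phi_phiStar (m : ℕ) (a : ℂ) (n : ℕ) :
    (fun f => a • phi (-((m + 1 : ℕ) : ℤ)) (phiStar (-1) f))^[n] (ofXY 1) =
      (a ^ n * (n ! : ℂ)) • ofXY (iterTerm m n) := by
  induction n with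
  | zero => simp [iterTerm_zero]
  | succ n ih =>
    rw [Function.iterate_succ_apply', ih, phiStar_smul, phi_smul, phi_phiStar_iterTerm, smul_smul,
      smul_smul, Nat.factorial_succ]
    congr 1
    push_cast
    ring

end Iterate

/-! ### Rearranging double sums, evaluation at `s = 1`, and exponentials. -/

section Evaluation

theorem formalSum_formalSum {F : ℕ → ℕ → XY} (hF : ∀ l i, WeightGE (l + i) (F l i)) :
    (formalSum fun l => formalSum fun i => F l i) =
      formalSum fun n => ∑ p ∈ Finset.HasAntidiagonal.antidiagonal n, F p.1 p.2 := by
  ext d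
  have hi : ∀ l i, WeightGE i (F l i) := fun l i => (hF l i).mono (Nat.le_add_left i l)
  have hl : ∀ l i, WeightGE l (F l i) := fun l i => (hF l i).mono (Nat.le_add_right l i)
  have hM := Nat.lt_succ_self (weight d)
  rw [coeff_formalSum_eq_sum (fun l => WeightGE.formalSum (hi l) (hl l)) hM,
    coeff_formalSum_eq_sum (fun n => WeightGE.sum fun p hp => (hF p.1 p.2).mono
      (Finset.HasAntidiagonal.mem_antidiagonal.1 hp).ge) hM]
  have e1 : ∀ n, MvPowerSeries.coeff d
        (∑ p ∈ Finset.HasAntidiagonal.antidiagonal n, F p.1 p.2)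
      = ∑ k ∈ Finset.range (n + 1), MvPowerSeries.coeff d (F k (n - k)) := by
    intro n
    rw [map_sum, Finset.Nat.sum_antidiagonal_eq_sum_range_succ_mk]
  simp only [e1]
  rw [Finset.sum_range_diag_flip _ fun k i => MvPowerSeries.coeff d (F k i)]
  refine Finset.sum_congr rfl fun l _ => ?_
  rw [coeff_formalSum_eq_sum (hi l) hM]
  refine (Finset.sum_subset (Finset.range_mono (Nat.sub_le _ _)) fun i _ h => ?_).symm
  have h' : (weight d).succ - l ≤ i := by simpa using h
  exact hF l i d (by omega)

/-- The `n`-th coefficient has weight at least `n`, so that the series may be evaluated at `1`. -/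
def Evaluable (A : XY⟦X⟧) : Prop := ∀ n, WeightGE n (coeff n A)

/-- The value at `1` of an evaluable power series. -/
def evalOne (A : XY⟦X⟧) : XY := formalSum fun n : ℕ => coeff n A

theorem Evaluable.mul {A B : XY⟦X⟧} (hA : Evaluable A) (hB : Evaluable B) : Evaluable (A * B) := by
  intro n
  rw [coeff_mul]
  refine WeightGE.sum fun p hp => ?_
  rw [← Finset.HasAntidiagonal.mem_antidiagonal.1 hp]
  exact (hA _).mul (hB _)

theorem Evaluable.one : Evaluable 1 := by
  intro n
  rcases Nat.eq_zero_or_pos n with rfl | hn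
  · exact WeightGE.of_zero _
  · rw [coeff_one, if_neg hn.ne']
    exact WeightGE.zero n

theorem Evaluable.pow {A : XY⟦X⟧} (hA : Evaluable A) (m : ℕ) : Evaluable (A ^ m) := by
  induction m with
  | zero => rw [pow_zero]; exact Evaluable.one
  | succ m ih => rw [pow_succ]; exact ih.mul hA

theorem evalOne_mul {A B : XY⟦X⟧} (hA : Evaluable A) (hB : Evaluable B) :
    evalOne (A * B) = evalOne A * evalOne B := by
  have h := formalSum_formalSum (F := fun l i => coeff l A * coeff i B)
    fun l i => (hA l).mul (hB i)
  simp only [← coeff_mul] at h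
  rw [evalOne, ← h, evalOne, evalOne]
  simp only [← mul_formalSum hB]
  simp only [mul_comm _ (formalSum fun i => coeff i B)]
  rw [mul_formalSum hA]

theorem evalOne_one : evalOne 1 = 1 := by
  rw [evalOne, formalSum_eq_single 0]
  · simp
  · intro i hi
    rw [coeff_one, if_neg hi]

theorem evalOne_pow {A : XY⟦X⟧} (hA : Evaluable A) (m : ℕ) : evalOne (A ^ m) = evalOne A ^ m := by
  induction m with
  | zero => rw [pow_zero, pow_zero, evalOne_one]
  | succ m ih => rw [pow_succ, pow_succ, evalOne_mul (hA.pow m) hA, ih]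

theorem evaluable_genSeries {t : ℕ+ → XY} (ht : ∀ n : ℕ+, WeightGE n (t n)) :
    Evaluable (genSeries t) := by
  intro n
  cases n with
  | zero => exact WeightGE.of_zero _
  | succ n =>
    rw [coeff_genSeries_succ]
    exact ht n.succPNat

/-- Evaluation at `1` is multiplicative on evaluable series, so it commutes with the exponential
series; the weight bound makes every sum finite in each coefficient. -/
theorem expXY_evalOne_genSeries {t : ℕ+ → XY} (ht : ∀ n : ℕ+, WeightGE n (t n)) :
    expXY (evalOne (genSeries t)) = formalSum fun l : ℕ => schurS t (l : ℤ) := by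
  have hE := evaluable_genSeries ht
  have hw : WeightGE 1 (evalOne (genSeries t)) := by
    refine WeightGE.formalSum hE fun n => ?_
    cases n with
    | zero => simpa using WeightGE.zero 1
    | succ n => exact (hE (n + 1)).mono (by omega)
  have h0 : MvPowerSeries.constantCoeff (evalOne (genSeries t)) = 0 :=
    hw.constantCoeff_eq_zero one_pos
  ext d
  have hM := Nat.lt_succ_self (weight d)
  rw [expXY, PowerSeries.coeff_subst (PowerSeries.HasSubst.of_constantCoeff_zero h0),
    coeff_formalSum_eq_sum (fun l => WeightGE.schurS ht l) hM]
  have hsub : (Function.support fun m : ℕ => coeff m (PowerSeries.exp ℂ) •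
      MvPowerSeries.coeff d (evalOne (genSeries t) ^ m)) ⊆ ↑(Finset.range (weight d).succ) := by
    intro m hm
    by_contra h
    have h' : (weight d).succ ≤ m := by simpa using h
    refine hm ?_
    simp only
    rw [hw.pow m d (by omega), smul_zero]
  rw [finsum_eq_sum_of_support_subset _ hsub]
  have e1 : ∀ l ∈ Finset.range (weight d).succ, MvPowerSeries.coeff d (schurS t (l : ℤ))
      = ∑ m ∈ Finset.range (weight d).succ,
        ((m ! : ℂ)⁻¹) * MvPowerSeries.coeff d (coeff l (genSeries t ^ m)) := by
    intro l hl
    rw [schurS_eq_sum_range t (Finset.mem_range.1 hl), map_sum]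
    rfl
  rw [Finset.sum_congr rfl e1, Finset.sum_comm]
  refine Finset.sum_congr rfl fun m _ => ?_
  rw [← evalOne_pow hE, evalOne, coeff_formalSum_eq_sum (hE.pow m) hM, ← Finset.mul_sum,
    PowerSeries.coeff_exp]
  simp

/-- Homogeneity turns evaluation at `s = θ` into evaluation at `s = 1`, so no smallness of `θ` is
needed. -/
theorem schurS_mul_pow {K : Type*} [CommRing K] [Algebra ℂ K] (t : ℕ+ → K) (θ : K) (l : ℕ) :
    schurS (fun n => t n * θ ^ (n : ℕ)) (l : ℤ) = θ ^ l * schurS t (l : ℤ) := by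
  have h : genSeries (fun n => t n * θ ^ (n : ℕ)) = PowerSeries.rescale θ (genSeries t) := by
    ext n
    cases n with
    | zero => simp
    | succ n =>
      rw [PowerSeries.coeff_rescale, coeff_genSeries_succ, coeff_genSeries_succ, mul_comm]
      rfl
  rw [schurS_natCast, schurS_natCast, Finset.mul_sum]
  refine Finset.sum_congr rfl fun m _ => ?_
  rw [h, ← map_pow, PowerSeries.coeff_rescale, mul_smul_comm]

/-- The negative binomial series: `D ^ (l + 1) ∑_i C(l + i, i) k ^ i = 1` for `D = 1 - k`. -/
theorem pow_mul_formalSum_choose {k : XY} (hk : WeightGE 1 k) (l : ℕ) :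
    (1 - k) ^ (l + 1) * (formalSum fun i => ((l + i).choose i : XY) * k ^ i) = 1 := by
  have hki : ∀ l i : ℕ, WeightGE i (((l + i).choose i : XY) * k ^ i) := fun l i =>
    ((hk.pow i).mono (by omega)).mul_left _
  have step : ∀ l : ℕ, (1 - k) * (formalSum fun i => ((l + i).choose i : XY) * k ^ i)
      = 1 + formalSum fun i => (((l + (1 + i)).choose (1 + i) : XY) - ((l + i).choose i : XY))
        * k ^ (1 + i) := by
    intro l
    have e1 := formalSum_eq_sum_add (hki l) 1
    have e2 : (formalSum fun i => ((l + (1 + i)).choose (1 + i) : XY) * k ^ (1 + i))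
        = (formalSum fun i => (((l + (1 + i)).choose (1 + i) : XY) - ((l + i).choose i : XY))
          * k ^ (1 + i)) + k * formalSum fun i => ((l + i).choose i : XY) * k ^ i := by
      rw [mul_formalSum (hki l), ← formalSum_add]
      · congr 1
        funext i
        ring
      · exact fun i => ((hk.pow (1 + i)).mono (by omega)).mul_left _
      · exact fun i => (hki l i).mul_left _
    rw [Finset.sum_range_one] at e1
    simp only [Nat.add_zero, Nat.choose_zero_right, Nat.cast_one, pow_zero, mul_one] at e1
    linear_combination e1 + e2
  induction l with
  | zero =>
    rw [zero_add, pow_one, step 0]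
    simp
  | succ l ih =>
    rw [pow_succ, mul_assoc, step (l + 1)]
    refine Eq.trans (congrArg ((1 - k) ^ (l + 1) * ·) ?_) ih
    rw [formalSum_eq_sum_add (hki l) 1, Finset.sum_range_one]
    simp only [Nat.add_zero, Nat.choose_zero_right, Nat.cast_one, pow_zero, mul_one]
    refine congrArg (fun f => 1 + formalSum f) (funext fun i => ?_)
    have : (l + 1 + (1 + i)).choose (1 + i) = (l + 1 + i).choose i + (l + (1 + i)).choose (1 + i) := by
      rw [show l + 1 + (1 + i) = (l + 1 + i) + 1 by ring, show 1 + i = i + 1 by ring,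
        Nat.choose_succ_succ, show l + (i + 1) = l + 1 + i by ring]
    rw [this]
    push_cast
    ring

end Evaluation

/-! ### Summation of the exponential series. -/

section Final

theorem weightGE_weightedX (b : ℕ) : WeightGE b (weightedX b) := by
  rcases Nat.eq_zero_or_pos b with rfl | hb
  · exact WeightGE.of_zero _
  · obtain ⟨n, rfl⟩ : ∃ k : ℕ+, (k : ℕ) = b := ⟨⟨b, hb⟩, rfl⟩
    rw [weightedX_coe]
    exact (WeightGE.of_x n).smul _

theorem weightGE_binomSum (n : ℕ) : WeightGE n (binomSum (x 1 + y 1) weightedX n 0) := by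
  refine WeightGE.sum fun i _ => ?_
  exact ((weightGE_weightedX _).mul_left _).mono (by omega)

theorem weightGE_lamArg (n : ℕ+) : WeightGE n (lamArg (x 1 + y 1) weightedX n) :=
  (weightGE_binomSum n).smul _

theorem weightGE_coeff_gSeries (l : ℕ) : WeightGE l (coeff l gSeries) := by
  rw [gSeries, coeff_schurGen]
  exact WeightGE.schurS weightGE_lamArg l

/-- `S_{m+2}(-x-y) + S_1(x+y) S_{m+1}(-x-y)`. -/
def kappa (m : ℕ) : XY := Sminus ((m + 2 : ℕ) : ℤ) + (x 1 + y 1) * Sminus ((m + 1 : ℕ) : ℤ)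

theorem weightGE_kappa (m : ℕ) : WeightGE 1 (kappa m) :=
  ((weightGE_Sminus (m + 2)).mono (by omega)).add
    (((weightGE_Sminus (m + 1)).mono (by omega)).mul_left _)

theorem den_eq (a : ℂ) (m : ℕ) : den a (m + 1) = 1 - a • kappa m := by
  rw [den, kappa, Splus_one, smul_add]
  push_cast
  rw [show (m : ℤ) + 1 + 1 = m + 2 by ring]
  ring

theorem constantCoeff_den (a : ℂ) (m : ℕ) :
    MvPowerSeries.constantCoeff (den a (m + 1)) = 1 := by
  rw [den_eq, map_sub, map_one, ((weightGE_kappa m).smul a).constantCoeff_eq_zero one_pos, sub_zero]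

theorem den_mul_inv (a : ℂ) (m : ℕ) : den a (m + 1) * (den a (m + 1))⁻¹ = 1 :=
  MvPowerSeries.mul_inv_cancel _ (by rw [constantCoeff_den]; exact one_ne_zero)

theorem coeff_symbol_pow (m : ℕ) {n i l : ℕ} (h : i + l = n) :
    coeff i (symbol m ^ n) = (n.choose i : XY) * (Sminus (m : ℤ) ^ l * kappa m ^ i) := by
  have hs : symbol m = X * C (kappa m) + C (Sminus (m : ℤ)) := by
    rw [symbol, kappa, add_comm]
  rw [hs, add_pow, map_sum, Finset.sum_eq_single i]
  · have e : (X * C (kappa m)) ^ i * C (Sminus (m : ℤ)) ^ (n - i) * (n.choose i : XY⟦X⟧)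
        = X ^ i * C ((n.choose i : XY) * (Sminus (m : ℤ) ^ l * kappa m ^ i)) := by
      rw [show n - i = l by omega, map_mul, map_mul, map_pow, map_pow, map_natCast]
      ring
    rw [e]
    have := coeff_X_pow_mul (C ((n.choose i : XY) * (Sminus (m : ℤ) ^ l * kappa m ^ i))) i 0
    rw [zero_add] at this
    rw [this]
    simp
  · intro k _ hk
    have e : (X * C (kappa m)) ^ k * C (Sminus (m : ℤ)) ^ (n - k) * (n.choose k : XY⟦X⟧)
        = C (kappa m ^ k * Sminus (m : ℤ) ^ (n - k) * (n.choose k : XY)) * X ^ k := by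
      rw [map_mul, map_mul, map_pow, map_pow, map_natCast]
      ring
    rw [e, coeff_C_mul, coeff_X_pow, if_neg hk.symm, mul_zero]
  · intro h'
    exact absurd (Finset.mem_range.2 (by omega)) h'

theorem pow_smul_iterTerm (a : ℂ) (m n : ℕ) : a ^ n • iterTerm m n =
    ∑ p ∈ Finset.HasAntidiagonal.antidiagonal n, ((p.1 + p.2).choose p.2 : XY) *
      (a • kappa m) ^ p.2 * ((a • Sminus (m : ℤ)) ^ p.1 * coeff p.1 gSeries) := by
  rw [iterTerm, coeff_mul, Finset.smul_sum, ← Finset.Nat.sum_antidiagonal_swap]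
  refine Finset.sum_congr rfl fun p hp => ?_
  have hp' := Finset.HasAntidiagonal.mem_antidiagonal.1 hp
  simp only [Prod.fst_swap, Prod.snd_swap]
  rw [coeff_symbol_pow m (i := p.2) (l := p.1) (by omega), smul_pow, smul_pow, ← hp', pow_add]
  simp only [Algebra.smul_def, map_mul]
  ring

theorem weightGE_iterTerm_summand (a : ℂ) (m l i : ℕ) :
    WeightGE (l + i) (((l + i).choose i : XY) * (a • kappa m) ^ i *
      ((a • Sminus (m : ℤ)) ^ l * coeff l gSeries)) := by
  have h1 : WeightGE i (((l + i).choose i : XY) * (a • kappa m) ^ i) :=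
    ((((weightGE_kappa m).smul a).pow i).mono (by omega)).mul_left _
  exact (h1.mul ((weightGE_coeff_gSeries l).mul_left _)).mono (by omega)

theorem weightGE_pow_smul_iterTerm (a : ℂ) (m n : ℕ) : WeightGE n (a ^ n • iterTerm m n) := by
  rw [pow_smul_iterTerm]
  exact WeightGE.sum fun p hp => (weightGE_iterTerm_summand a m p.1 p.2).mono
    (Finset.HasAntidiagonal.mem_antidiagonal.1 hp).ge

/-- Grouping by the power `l` of `N_m`, the inner sum over powers of `a κ` is the negative binomial
series for `D^{-(l+1)}`; one factor `D⁻¹` comes out and the others join `(a N_m)^l`. -/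
theorem formalSum_iterTerm (a : ℂ) (m : ℕ) :
    (formalSum fun n => a ^ n • iterTerm m n) = (den a (m + 1))⁻¹ *
      formalSum fun l : ℕ => (a • Sminus (m : ℤ) * (den a (m + 1))⁻¹) ^ l * coeff l gSeries := by
  simp only [pow_smul_iterTerm]
  rw [← formalSum_formalSum (F := fun l i => ((l + i).choose i : XY) * (a • kappa m) ^ i *
      ((a • Sminus (m : ℤ)) ^ l * coeff l gSeries)) (weightGE_iterTerm_summand a m),
    mul_formalSum (fun l => (weightGE_coeff_gSeries l).mul_left _)]
  congr 1
  funext l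
  have hk := (weightGE_kappa m).smul a
  have hB := pow_mul_formalSum_choose hk l
  rw [← den_eq] at hB
  have hD := den_mul_inv a m
  set D := den a (m + 1)
  set B := formalSum fun i => ((l + i).choose i : XY) * (a • kappa m) ^ i
  have hDl : D ^ (l + 1) * D⁻¹ ^ (l + 1) = 1 := by rw [← mul_pow, hD, one_pow]
  -- Both sides are inverse to `D ^ (l + 1)`.
  have hBD : B = D⁻¹ ^ (l + 1) := by
    linear_combination (-B) * hDl + D⁻¹ ^ (l + 1) * hB
  have hf : (formalSum fun i => ((l + i).choose i : XY) * (a • kappa m) ^ i *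
      ((a • Sminus (m : ℤ)) ^ l * coeff l gSeries))
      = ((a • Sminus (m : ℤ)) ^ l * coeff l gSeries) * B := by
    rw [mul_formalSum fun i => ((hk.pow i).mono (by omega)).mul_left _]
    simp only [mul_comm ((a • Sminus (m : ℤ)) ^ l * coeff l gSeries)]
  rw [hf, hBD, mul_pow]
  ring

/-- The sign `(-1)^(n+1)` in `lamArg` absorbs both the outer minus sign and the one inside the
`n`-th power. -/
theorem neg_expTerm (a : ℂ) (m : ℕ) (n : ℕ+) : -expTerm a (m + 1) n =
    lamArg (x 1 + y 1) weightedX n * (a • Sminus (m : ℤ) * (den a (m + 1))⁻¹) ^ (n : ℕ) := by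
  have hn : ((n : ℕ) : ℂ) ≠ 0 := Nat.cast_ne_zero.2 n.ne_zero
  have hm : (((m + 1 : ℕ) : ℤ) - 1) = m := by push_cast; ring
  have hsum : (∑ i ∈ Finset.range ((n : ℕ) + 1),
      (((n : ℕ).choose i : ℂ) * (((n : ℕ) + i : ℕ) : ℂ) / ((n : ℕ) : ℂ)) •
        (Splus 1 ^ ((n : ℕ) - i) * x ⟨(n : ℕ) + i, Nat.add_pos_left n.pos i⟩))
      = (((n : ℕ) : ℂ)⁻¹) • binomSum (x 1 + y 1) weightedX n 0 := by
    rw [binomSum, Finset.smul_sum]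
    refine Finset.sum_congr rfl fun i _ => ?_
    have hx : weightedX (0 + (n : ℕ) + i) = (((n : ℕ) + i : ℕ) : ℂ) •
        x ⟨(n : ℕ) + i, Nat.add_pos_left n.pos i⟩ := by
      rw [zero_add]
      exact weightedX_coe ⟨(n : ℕ) + i, Nat.add_pos_left n.pos i⟩
    rw [hx, Splus_one]
    simp only [Algebra.smul_def, div_eq_mul_inv, map_mul, map_natCast]
    ring
  rw [expTerm, hsum, hm, lamArg, neg_mul, neg_pow, div_eq_mul_inv, mul_smul]
  simp only [Algebra.smul_def, map_pow, map_neg, map_one]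
  ring

theorem formalSum_pnat (f : ℕ+ → XY) : formalSum f = formalSum fun n : ℕ => f n.succPNat := by
  ext d
  rw [coeff_formalSum, coeff_formalSum]
  exact (finsum_comp_equiv (f := fun i => MvPowerSeries.coeff d (f i)) Equiv.pnatEquivNat.symm).symm

theorem formalSum_neg {ι : Type*} (f : ι → XY) :
    (formalSum fun i => -f i) = -formalSum f := by
  have := formalSum_smul (-1) f
  simpa using this

theorem weightGE_expTerm (a : ℂ) (m : ℕ) (n : ℕ+) : WeightGE n (expTerm a (m + 1) n) := by
  rw [← neg_neg (expTerm a (m + 1) n), neg_expTerm]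
  exact ((weightGE_lamArg n).mul_right _).neg

theorem expXY_neg_formalSum_expTerm (a : ℂ) (m : ℕ) :
    expXY (-formalSum (expTerm a (m + 1))) =
      formalSum fun l : ℕ => (a • Sminus (m : ℤ) * (den a (m + 1))⁻¹) ^ l * coeff l gSeries := by
  set θ := a • Sminus (m : ℤ) * (den a (m + 1))⁻¹
  have ht : ∀ n : ℕ+, WeightGE n (lamArg (x 1 + y 1) weightedX n * θ ^ (n : ℕ)) :=
    fun n => (weightGE_lamArg n).mul_right _
  have h := expXY_evalOne_genSeries ht
  have hE : evalOne (genSeries fun n => lamArg (x 1 + y 1) weightedX n * θ ^ (n : ℕ))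
      = -formalSum (expTerm a (m + 1)) := by
    rw [evalOne, formalSum_eq_sum_add (evaluable_genSeries ht) 1, Finset.sum_range_one,
      ← formalSum_neg, formalSum_pnat]
    simp only [neg_expTerm]
    have : ∀ i, coeff (1 + i) (genSeries fun n => lamArg (x 1 + y 1) weightedX n * θ ^ (n : ℕ))
        = lamArg (x 1 + y 1) weightedX i.succPNat * θ ^ ((i.succPNat : ℕ+) : ℕ) := by
      intro i
      rw [add_comm, coeff_genSeries_succ]
    simp only [this, coeff_zero_eq_constantCoeff, constantCoeff_genSeries, zero_add]
    rfl
  rw [hE] at h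
  rw [h]
  congr 1
  funext l
  rw [schurS_mul_pow, gSeries, coeff_schurGen]

theorem isExpApplied_iterTerm (a : ℂ) (m : ℕ) :
    IsExpApplied (fun f => a • phi (-((m + 1 : ℕ) : ℤ)) (phiStar (-1) f)) (ofXY 1)
      (ofXY (formalSum fun n => a ^ n • iterTerm m n)) := by
  intro k
  have h : ∀ n : ℕ, ((n ! : ℂ)⁻¹) •
      ((fun f => a • phi (-((m + 1 : ℕ) : ℤ)) (phiStar (-1) f))^[n] (ofXY 1)) k
      = a ^ n • ofXY (iterTerm m n) k := by
    intro n
    rw [iterate_phi_phiStar, Pi.smul_apply, smul_smul, mul_comm (a ^ n), ← mul_assoc,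
      inv_mul_cancel₀ (Nat.cast_ne_zero.2 n.factorial_ne_zero), one_mul]
  simp only [h]
  rcases eq_or_ne k 0 with rfl | hk
  · simp only [ofXY, Pi.single_eq_same]
    exact ⟨formallySummable_of_weightGE (weightGE_pow_smul_iterTerm a m), trivial⟩
  · simp only [ofXY, Pi.single_eq_of_ne hk, smul_zero, formalSum_zero, and_true]
    intro d
    simp

end Final

end

end FreeBoson

theorem theorem3p6 (j : ℕ) (hj : 1 ≤ j) (a : ℂ) :
    -- the right-hand side is well defined
    IsUnit (FreeBoson.den a j) ∧
    FreeBoson.FormallySummable (FreeBoson.expTerm a j) ∧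
    MvPowerSeries.constantCoeff (FreeBoson.formalSum (FreeBoson.expTerm a j)) = 0 ∧
    -- the left-hand side converges to the right-hand side
    FreeBoson.IsExpApplied
      (fun f => a • FreeBoson.phi (-(j : ℤ)) (FreeBoson.phiStar (-1) f))
      (FreeBoson.ofXY 1)
      (FreeBoson.ofXY ((FreeBoson.den a j)⁻¹ *
        FreeBoson.expXY (-FreeBoson.formalSum (FreeBoson.expTerm a j)))) := by
  obtain ⟨m, rfl⟩ : ∃ m, j = m + 1 := ⟨j - 1, by omega⟩
  have hw := FreeBoson.weightGE_expTerm a m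
  refine ⟨?_, ?_, ?_, ?_⟩
  · rw [MvPowerSeries.isUnit_iff_constantCoeff, FreeBoson.constantCoeff_den]
    exact isUnit_one
  · intro d
    refine (Set.finite_Iic (FreeBoson.weight d).succPNat).subset fun n hn => ?_
    by_contra h
    refine hn (hw n d ?_)
    have h' : (FreeBoson.weight d).succPNat < n := by simpa using h
    have h'' : ((FreeBoson.weight d).succPNat : ℕ) < n := h'
    rw [Nat.succPNat_coe] at h''
    omega
  · rw [FreeBoson.formalSum_pnat]
    refine FreeBoson.WeightGE.constantCoeff_eq_zero one_pos (FreeBoson.WeightGE.formalSum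
      (fun n => (hw n.succPNat).mono ?_) fun n => (hw n.succPNat).mono ?_)
    · rw [Nat.succPNat_coe]
      omega
    · rw [Nat.succPNat_coe]
      omega
  · rw [FreeBoson.expXY_neg_formalSum_expTerm, ← FreeBoson.formalSum_iterTerm]
    exact FreeBoson.isExpApplied_iterTerm a m
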